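/- **Calculus.** Fix base types $B$ (among them $\mathsf{Bool}$), constants $k$, each of exactly one base type $\mathrm{ty}(k)$, with $\mathrm{ty}(k)=\mathsf{Bool}$ iff $k\in\{\mathsf{true},\mathsf{false}\}$ (and $\mathsf{true}\neq\mathsf{false}$), and primitive operations $op$ with partial denotations $[\![op]\!]$ on constants. Types are $T ::= \{x{:}B\mid e\} \mid T_1\to T_2$ (the predicate $e$ has no free variable but $x$). Terms are $$e ::= x \mid k \mid \lambda x{:}T.\,e \mid e_1\,e_2 \mid op(e_1,\dots,e_n) \mid \langle T_1\overset{a}{\Rightarrow}T_2\rangle^{l}e \mid \langle\{x{:}B\mid e_1\},e_2,k\rangle^{l} \mid {\Uparrow}l$$ where an annotation $a$ is $\bullet$ or a finite set $\mathcal S$ of types, and a label $l$ is nonempty or the empty label. Put $\mathrm{dom}(\bullet)=\mathrm{cod}(\bullet)=\bullet$, and let $\mathrm{dom},\mathrm{cod}$ act elementwise on sets of function types. Fix a function $\mathrm{choose}$ with $\mathrm{choose}(\mathcal S)\in\mathcal S$ for all finite $\mathcal S\ne\emptyset$. There are two modes, classic ($\mathsf C$) and heedful ($\mathsf H$). **Values.**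 Constants and abstractions; in mode $\mathsf C$ also $\langle T_{11}\to T_{12}\overset{\bullet}{\Rightarrow}T_{21}\to T_{22}\rangle^l v$ with $v$ a value; in mode $\mathsf H$ also $\langle T_{11}\to T_{12}\overset{\mathcal S}{\Rightarrow}T_{21}\to T_{22}\rangle^l(\lambda x{:}T.\,e)$. **Reduction $\longrightarrow_m$** ($v$ stands for values of mode $m$). Both modes: - $(\lambda x{:}T.e)\,v\longrightarrow e[v/x]$; - $op(k_1,\dots,k_n)\longrightarrow[\![op]\!](k_1,\dots,k_n)$ if defined; - if $v'=\langle T_{11}\to T_{12}\overset{a}{\Rightarrow}T_{21}\to T_{22}\rangle^l e_1$ is a value, then $v'\,v\longrightarrow\langle T_{12}\overset{\mathrm{cod}(a)}{\Rightarrow}T_{22}\rangle^l\bigl(e_1\,(\langle T_{21}\overset{\mathrm{dom}(a)}{\Rightarrow}T_{11}\rangle^l v)\bigr)$; - $\langle\{x{:}B\mid e_1\},\mathsf{true},k\rangle^l\longrightarrow k$ and $\langle\{x{:}B\mid e_1\},\mathsf{false},k\rangle^l\longrightarrow{\Uparrow}l$; - left-to-right call-by-value congruence for applications and operations, congruence for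 the middle component of active checks, and propagation of ${\Uparrow}l$ out of all these positions. Mode $\mathsf C$ only: $\langle\{x{:}B\mid e_1\}\overset{\bullet}{\Rightarrow}\{x{:}B\mid e_2\}\rangle^l k\longrightarrow\langle\{x{:}B\mid e_2\},e_2[k/x],k\rangle^l$; congruence and blame propagation under casts annotated $\bullet$. Mode $\mathsf H$ only: - $\langle T_1\overset{\bullet}{\Rightarrow}T_2\rangle^l e\longrightarrow\langle T_1\overset{\emptyset}{\Rightarrow}T_2\rangle^l e$; - $\langle\{x{:}B\mid e_1\}\overset{\emptyset}{\Rightarrow}\{x{:}B\mid e_2\}\rangle^l k\longrightarrow\langle\{x{:}B\mid e_2\},e_2[k/x],k\rangle^l$; - $\langle\{x{:}B\mid e_1\}\overset{\mathcal S}{\Rightarrow}\{x{:}B\mid e_3\}\rangle^l k\longrightarrow\langle T\overset{\mathcal S\setminus\{T\}}{\Longrightarrow}\{x{:}B\mid e_3\}\rangle^l\langle T,e_2[k/x],k\rangle^l$ if $\mathcal S\neq\emptyset$ and $\mathrm{choose}(\mathcal S)=T=\{x{:}B\mid e_2\}$; - $\langle T_2\overset{\mathcal S_2}{\Rightarrow}T_3\rangle^{l_2}\langle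 T_1\overset{\mathcal S_1}{\Rightarrow}T_2\rangle^{l_1}e\longrightarrow\langle T_1\overset{\mathcal S_1\cup\mathcal S_2\cup\{T_2\}}{\Longrightarrow}T_3\rangle^{l_2}e$; - blame propagation under casts annotated with a set, and congruence under such casts when the argument is not itself a cast annotated with a set. **Typing in mode $m$.** $T_1\parallel T_2$ means that $T_1,T_2$ are equal up to refinement predicates. $\vdash_m\{x{:}B\mid\mathsf{true}\}$; $\vdash_m\{x{:}B\mid e\}$ if $x{:}\{x{:}B\mid\mathsf{true}\}\vdash_m e:\{x{:}\mathsf{Bool}\mid\mathsf{true}\}$; $\vdash_m T_1\to T_2$ if $\vdash_m T_1$ and $\vdash_m T_2$; $\vdash_m\Gamma$ if all types in $\Gamma$ are well formed. Variables (when $\vdash_m\Gamma$), abstractions ($\lambda x{:}T_1.e$ with $\vdash_m T_1$), applications and operations (typed by the first-order type of $op$) are typed as usual, without subsumption. Moreover $\Gamma\vdash_m k:\{x{:}B\mid e\}$ if $\vdash_m\Gamma$, $\mathrm{ty}(k)=B$, $\vdash_m\{x{:}B\mid e\}$ and $e[k/x]\longrightarrow_m^*\mathsf{true}$; $\Gamma\vdash_m\langle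 T_1\overset{a}{\Rightarrow}T_2\rangle^l e:T_2$ if $\Gamma\vdash_m e:T_1$, $\vdash_m T_1$, $\vdash_m T_2$, $T_1\parallel T_2$ and $a$ is $\bullet$ or ($m=\mathsf H$) a set all of whose elements are well formed and $\parallel T_1$; $\Gamma\vdash_m{\Uparrow}l:T$ if $\vdash_m\Gamma$ and $\vdash_m T$; and $\Gamma\vdash_m\langle\{x{:}B\mid e_1\},e_2,k\rangle^l:\{x{:}B\mid e_1\}$ if $\vdash_m\Gamma$, $\vdash_m\{x{:}B\mid e_1\}$, $\mathrm{ty}(k)=B$, $\emptyset\vdash_m e_2:\{x{:}\mathsf{Bool}\mid\mathsf{true}\}$ and $e_1[k/x]\longrightarrow^*_m e_2$. A typing or well-formedness derivation is one *of a source program (type)* if in it constants $k$ are typed only at $\{x{:}\mathrm{ty}(k)\mid\mathsf{true}\}$, all casts are annotated $\bullet$ and carry nonempty labels, and no active check and no ${\Uparrow}l$ occurs. **Assumptions on operations**, for both modes $m$: the argument types $\{x{:}B_i\mid p_i\}$ and the result type $\{x{:}B\mid p\}$ of $op$ are well formed in mode $m$; for constants with $\mathrm{ty}(k_i)=B_i$,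 $[\![op]\!](k_1,\dots,k_n)$ is defined iff $p_i[k_i/x]\longrightarrow_m^*\mathsf{true}$ for all $i$; and if it is defined with value $k$, then $\mathrm{ty}(k)=B$ and $p[k/x]\longrightarrow^*_m\mathsf{true}$. **Logical relation** (left: classic, right: heedful), by recursion on the type: - $v_1\sim v_2:\{x{:}B\mid e\}$ iff $v_1=v_2=k$ for a constant $k$ with $\mathrm{ty}(k)=B$ and $e[k/x]\longrightarrow^*_{\mathsf H}\mathsf{true}$; - $v_1\sim v_2:T_1\to T_2$ iff $v_1$ is a classic value, $v_2$ is a heedful value with $\emptyset\vdash_{\mathsf H}v_2:T_1\to T_2$, and $v_1\,w_1\simeq v_2\,w_2:T_2$ whenever $w_1\sim w_2:T_1$; - $e_1\simeq e_2:T$ iff either $e_1\longrightarrow^*_{\mathsf C}{\Uparrow}l$ and $e_2\longrightarrow^*_{\mathsf H}{\Uparrow}l'$ for some labels $l,l'$ (possibly different), or $e_1\longrightarrow^*_{\mathsf C}v_1$ and $e_2\longrightarrow^*_{\mathsf H}v_2$ for values with $v_1\sim v_2:T$; - on types, $\{x{:}B\mid e_1\}\sim\{x{:}B\mid e_2\}$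 iff $e_1[w_1/x]\simeq e_2[w_2/x]:\{x{:}\mathsf{Bool}\mid\mathsf{true}\}$ whenever $w_1\sim w_2:\{x{:}B\mid\mathsf{true}\}$, and $T_{11}\to T_{12}\sim T_{21}\to T_{22}$ iff $T_{11}\sim T_{21}$ and $T_{12}\sim T_{22}$; no other types are related; - $\Gamma\models\delta$, for $\delta=(\delta_1,\delta_2)$, iff $\delta_1(x)\sim\delta_2(x):\Gamma(x)$ for all $x\in\mathrm{dom}(\Gamma)$; and $\Gamma\vdash e_1\simeq e_2:T$ iff $\delta_1(e_1)\simeq\delta_2(e_2):T$ for all $\Gamma\models\delta$. **Lemma (relating classic and heedful source programs).** 1. If $\Gamma\vdash_{\mathsf C}e:T$ as a source program, then $\Gamma\vdash e\simeq e:T$. 2. If $\vdash_{\mathsf C}T$ as a source type, then $T\sim T$. 3. In particular, if $\Gamma\vdash_{\mathsf C}e:T$ as a source program and $\Gamma\models\delta$, then $\delta_1(e)$ raises blame classically (i.e. $\delta_1(e)\longrightarrow_{\mathsf C}^*{\Uparrow}l$ for some $l$) iff $\delta_2(e)$ raises blame heedfully (possibly with a different label); and whenever $\delta_1(e)\longrightarrow_{\mathsf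 C}^*v_1$ and $\delta_2(e)\longrightarrow_{\mathsf H}^*v_2$ for a classic value $v_1$ and a heedful value $v_2$, then $v_1\sim v_2:T$. -/

import Mathlib

/-- The two modes of the calculus that are compared: classic and heedful. -/
inductive Mode : Type where
  | classic
  | heedful

/-- Base types, constants, primitive operations and their denotations, and the nonempty blame
labels. `Bool` is a base type whose only constants are `true` and `false`. Constants of distinct
base types are distinct, since every constant has exactly one base type `ty k`. -/
structure Signature : Type 1 where
  Base : Type
  bool : Base
  Const : Type
  ty : Const → Base
  tt : Const
  ff : Const
  tt_ne_ff : tt ≠ ff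
  ty_eq_bool_iff : ∀ k, ty k = bool ↔ k = tt ∨ k = ff
  Op : Type
  arity : Op → ℕ
  denote : (o : Op) → (Fin (arity o) → Const) → Option Const
  Label : Type

section

variable {Sg : Signature}

/- Types, terms and cast annotations. Variables are de Bruijn indices. In a refinement
`{x:B | e}` the variable `x` is index `0` of `e`; the predicate has no other free variable, so
types are closed and renaming and substitution do not act on types and annotations. A label is
either a nonempty one or the empty label `none`. -/
mutual
inductive Ty (Sg : Signature) : Type where
  /-- `{x:B | e}` -/
  | refine : Sg.Base → Tm Sg → Ty Sg
  /-- `T₁ → T₂` -/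
  | arrow : Ty Sg → Ty Sg → Ty Sg
inductive Tm (Sg : Signature) : Type where
  | var : ℕ → Tm Sg
  | const : Sg.Const → Tm Sg
  /-- `λ x:T. e` -/
  | lam : Ty Sg → Tm Sg → Tm Sg
  | app : Tm Sg → Tm Sg → Tm Sg
  | op : (o : Sg.Op) → (Fin (Sg.arity o) → Tm Sg) → Tm Sg
  /-- the cast `⟨T₁ ⇒ᵃ T₂⟩ˡ e` -/
  | cast : Ty Sg → Ann Sg → Ty Sg → Option Sg.Label → Tm Sg → Tm Sg
  /-- the active check `⟨{x:B | e₁}, e₂, k⟩ˡ` -/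
  | check : Sg.Base → Tm Sg → Tm Sg → Sg.Const → Option Sg.Label → Tm Sg
  /-- `⇑l` -/
  | blame : Option Sg.Label → Tm Sg
inductive Ann (Sg : Signature) : Type where
  /-- the empty annotation `•` -/
  | none : Ann Sg
  /-- raw code of a type set, see `Ann.ofFinset` -/
  | rawSet : List (Ty Sg) → Ann Sg
end

open Classical in
/-- The annotation that carries the finite set of types `S`. `Finset.toList` is a fixed injective
choice of an enumeration, so these annotations are exactly the finite sets of types; all rules
below mention sets only in this form. -/
noncomputable def Ann.ofFinset (S : Finset (Ty Sg)) : Ann Sg := .rawSet S.toList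

theorem Ann.ofFinset_injective :
    Function.Injective (Ann.ofFinset : Finset (Ty Sg) → Ann Sg) := by
  intro S S' h
  have h2 : S.toList = S'.toList := by
    unfold Ann.ofFinset at h
    injection h
  ext a
  rw [← Finset.mem_toList, h2, Finset.mem_toList]

/-- the refinement `{x:B | true}` -/
def Ty.triv (B : Sg.Base) : Ty Sg := .refine B (.const Sg.tt)

/-- domain of a function type (the identity on refinements, where it is never used) -/
def Ty.dom : Ty Sg → Ty Sg
  | .refine B e => .refine B e
  | .arrow T _ => T

/-- codomain of a function type (the identity on refinements, where it is never used) -/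
def Ty.cod : Ty Sg → Ty Sg
  | .refine B e => .refine B e
  | .arrow _ T => T

def Tm.liftRen (f : ℕ → ℕ) : ℕ → ℕ
  | 0 => 0
  | n + 1 => f n + 1

def Tm.rename : Tm Sg → (ℕ → ℕ) → Tm Sg
  | .var n, f => .var (f n)
  | .const k, _ => .const k
  | .lam T e, f => .lam T (e.rename (Tm.liftRen f))
  | .app e₁ e₂, f => .app (e₁.rename f) (e₂.rename f)
  | .op o es, f => .op o (fun i => (es i).rename f)
  | .cast T₁ a T₂ l e, f => .cast T₁ a T₂ l (e.rename f)
  | .check B e₁ e₂ k l, f => .check B e₁ (e₂.rename f) k l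
  | .blame l, _ => .blame l

def Tm.liftSubst (s : ℕ → Tm Sg) : ℕ → Tm Sg
  | 0 => .var 0
  | n + 1 => (s n).rename Nat.succ

/-- simultaneous capture-avoiding substitution -/
def Tm.subst : Tm Sg → (ℕ → Tm Sg) → Tm Sg
  | .var n, s => s n
  | .const k, _ => .const k
  | .lam T e, s => .lam T (e.subst (Tm.liftSubst s))
  | .app e₁ e₂, s => .app (e₁.subst s) (e₂.subst s)
  | .op o es, s => .op o (fun i => (es i).subst s)
  | .cast T₁ a T₂ l e, s => .cast T₁ a T₂ l (e.subst s)
  | .check B e₁ e₂ k l, s => .check B e₁ (e₂.subst s) k l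
  | .blame l, _ => .blame l

/-- `e.inst v` is `e[v/x]`, where `x` is index `0` of `e` -/
def Tm.inst (e v : Tm Sg) : Tm Sg :=
  e.subst (fun n => match n with
    | 0 => v
    | n + 1 => .var n)

/-- The remaining parameters of the calculus: the function `choose` picking the next type to check
out of a nonempty type set, and the (first-order) types of the primitive operations:
`{x:argBase o i | argPred o i}` for the `i`-th argument, `{x:resBase o | resPred o}` for the
result. -/
structure Params (Sg : Signature) : Type where
  choose : Finset (Ty Sg) → Ty Sg
  choose_mem : ∀ S : Finset (Ty Sg), S.Nonempty → choose S ∈ S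
  argBase : (o : Sg.Op) → Fin (Sg.arity o) → Sg.Base
  argPred : (o : Sg.Op) → Fin (Sg.arity o) → Tm Sg
  resBase : Sg.Op → Sg.Base
  resPred : Sg.Op → Tm Sg

/-- Values of each mode. Function proxies are unbounded in the classic mode; in the heedful mode a
proxy carries a type set and wraps an abstraction. -/
inductive Val : Mode → Tm Sg → Prop where
  | const {m : Mode} (k : Sg.Const) : Val m (.const k)
  | lam {m : Mode} (T : Ty Sg) (e : Tm Sg) : Val m (.lam T e)
  | proxyC {T₁₁ T₁₂ T₂₁ T₂₂ : Ty Sg} {l : Option Sg.Label} {e : Tm Sg} :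
      Val .classic e →
      Val .classic (.cast (.arrow T₁₁ T₁₂) .none (.arrow T₂₁ T₂₂) l e)
  | proxyH {T₁₁ T₁₂ T₂₁ T₂₂ : Ty Sg} {S : Finset (Ty Sg)} {l : Option Sg.Label}
      {T : Ty Sg} {e : Tm Sg} :
      Val .heedful (.cast (.arrow T₁₁ T₁₂) (.ofFinset S) (.arrow T₂₁ T₂₂) l (.lam T e))

/-- The annotations `a` with which evaluation in mode `m` may enter a cast: `•` in the classic
mode, type sets in the heedful mode (a heedful cast annotated `•` first gets the empty set). -/
inductive RunAnn : Mode → Ann Sg → Prop where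
  | classic : RunAnn .classic .none
  | heedful (S : Finset (Ty Sg)) : RunAnn .heedful (.ofFinset S)

open Classical in
/-- `AnnDom a a'`: `a'` is `dom(a)`, taken pointwise on type sets. -/
inductive AnnDom : Ann Sg → Ann Sg → Prop where
  | none : AnnDom .none .none
  | set (S : Finset (Ty Sg)) : AnnDom (.ofFinset S) (.ofFinset (S.image Ty.dom))

open Classical in
/-- `AnnCod a a'`: `a'` is `cod(a)`, taken pointwise on type sets. -/
inductive AnnCod : Ann Sg → Ann Sg → Prop where
  | none : AnnCod .none .none
  | set (S : Finset (Ty Sg)) : AnnCod (.ofFinset S) (.ofFinset (S.image Ty.cod))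

/-- `e` is a cast annotated with a type set, so a heedful cast around it merges with it. -/
def Mergeable (e : Tm Sg) : Prop :=
  ∃ (T₁ T₂ : Ty Sg) (S : Finset (Ty Sg)) (l : Option Sg.Label) (e' : Tm Sg),
    e = .cast T₁ (.ofFinset S) T₂ l e'

open Classical in
/-- Call-by-value small-step reduction `e ⟶ₘ e'`. -/
inductive Step (P : Params Sg) : Mode → Tm Sg → Tm Sg → Prop where
  | beta {m : Mode} {T : Ty Sg} {e v : Tm Sg} : Val m v →
      Step P m (.app (.lam T e) v) (e.inst v)
  | op {m : Mode} {o : Sg.Op} {ks : Fin (Sg.arity o) → Sg.Const} {k : Sg.Const} :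
      Sg.denote o ks = some k →
      Step P m (.op o (fun i => .const (ks i))) (.const k)
  | unwrap {m : Mode} {T₁₁ T₁₂ T₂₁ T₂₂ : Ty Sg} {a ad ac : Ann Sg} {l : Option Sg.Label}
      {e₁ e₂ : Tm Sg} :
      Val m (.cast (.arrow T₁₁ T₁₂) a (.arrow T₂₁ T₂₂) l e₁) → Val m e₂ →
      AnnDom a ad → AnnCod a ac →
      Step P m (.app (.cast (.arrow T₁₁ T₁₂) a (.arrow T₂₁ T₂₂) l e₁) e₂)
        (.cast T₁₂ ac T₂₂ l (.app e₁ (.cast T₂₁ ad T₁₁ l e₂)))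
  -- classic: check the target refinement
  | checkNone {B : Sg.Base} {e₁ e₂ : Tm Sg} {l : Option Sg.Label} {k : Sg.Const} :
      Step P .classic (.cast (.refine B e₁) .none (.refine B e₂) l (.const k))
        (.check B e₂ (e₂.inst (.const k)) k l)
  -- heedful: annotate a fresh cast with the empty type set
  | typeSet {T₁ T₂ : Ty Sg} {l : Option Sg.Label} {e : Tm Sg} :
      Step P .heedful (.cast T₁ .none T₂ l e) (.cast T₁ (.ofFinset ∅) T₂ l e)
  | checkEmpty {B : Sg.Base} {e₁ e₂ : Tm Sg} {l : Option Sg.Label} {k : Sg.Const} :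
      Step P .heedful (.cast (.refine B e₁) (.ofFinset ∅) (.refine B e₂) l (.const k))
        (.check B e₂ (e₂.inst (.const k)) k l)
  | checkSet {B : Sg.Base} {e₁ e₂ e₃ : Tm Sg} {S : Finset (Ty Sg)} {l : Option Sg.Label}
      {k : Sg.Const} :
      S.Nonempty → P.choose S = .refine B e₂ →
      Step P .heedful (.cast (.refine B e₁) (.ofFinset S) (.refine B e₃) l (.const k))
        (.cast (.refine B e₂) (.ofFinset (S.erase (.refine B e₂))) (.refine B e₃) l
          (.check B e₂ (e₂.inst (.const k)) k l))
  | castMerge {T₁ T₂ T₃ : Ty Sg} {S₁ S₂ : Finset (Ty Sg)} {l₁ l₂ : Option Sg.Label}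
      {e : Tm Sg} :
      Step P .heedful (.cast T₂ (.ofFinset S₂) T₃ l₂ (.cast T₁ (.ofFinset S₁) T₂ l₁ e))
        (.cast T₁ (.ofFinset (S₁ ∪ S₂ ∪ {T₂})) T₃ l₂ e)
  | checkOK {m : Mode} {B : Sg.Base} {e₁ : Tm Sg} {k : Sg.Const} {l : Option Sg.Label} :
      Step P m (.check B e₁ (.const Sg.tt) k l) (.const k)
  | checkFail {m : Mode} {B : Sg.Base} {e₁ : Tm Sg} {k : Sg.Const} {l : Option Sg.Label} :
      Step P m (.check B e₁ (.const Sg.ff) k l) (.blame l)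
  -- congruence
  | appL {m : Mode} {e₁ e₁' e₂ : Tm Sg} : Step P m e₁ e₁' →
      Step P m (.app e₁ e₂) (.app e₁' e₂)
  | appR {m : Mode} {e₁ e₂ e₂' : Tm Sg} : Val m e₁ → Step P m e₂ e₂' →
      Step P m (.app e₁ e₂) (.app e₁ e₂')
  | opInner {m : Mode} {o : Sg.Op} {es : Fin (Sg.arity o) → Tm Sg} {i : Fin (Sg.arity o)}
      {e' : Tm Sg} :
      (∀ j < i, Val m (es j)) → Step P m (es i) e' →
      Step P m (.op o es) (.op o (Function.update es i e'))
  | castInner {m : Mode} {T₁ T₂ : Ty Sg} {a : Ann Sg} {l : Option Sg.Label} {e e' : Tm Sg} :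
      RunAnn m a → (m = .heedful → ¬ Mergeable e) → Step P m e e' →
      Step P m (.cast T₁ a T₂ l e) (.cast T₁ a T₂ l e')
  | checkInner {m : Mode} {B : Sg.Base} {e₁ e₂ e₂' : Tm Sg} {k : Sg.Const}
      {l : Option Sg.Label} : Step P m e₂ e₂' →
      Step P m (.check B e₁ e₂ k l) (.check B e₁ e₂' k l)
  -- propagation of blame
  | appRaiseL {m : Mode} {l : Option Sg.Label} {e₂ : Tm Sg} :
      Step P m (.app (.blame l) e₂) (.blame l)
  | appRaiseR {m : Mode} {l : Option Sg.Label} {e₁ : Tm Sg} : Val m e₁ →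
      Step P m (.app e₁ (.blame l)) (.blame l)
  | opRaise {m : Mode} {o : Sg.Op} {es : Fin (Sg.arity o) → Tm Sg} {i : Fin (Sg.arity o)}
      {l : Option Sg.Label} :
      (∀ j < i, Val m (es j)) → es i = .blame l →
      Step P m (.op o es) (.blame l)
  | castRaise {m : Mode} {T₁ T₂ : Ty Sg} {a : Ann Sg} {l l' : Option Sg.Label} :
      RunAnn m a →
      Step P m (.cast T₁ a T₂ l (.blame l')) (.blame l')
  | checkRaise {m : Mode} {B : Sg.Base} {e₁ : Tm Sg} {k : Sg.Const} {l l' : Option Sg.Label} :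
      Step P m (.check B e₁ (.blame l') k l) (.blame l')

/-- `e ⟶*ₘ e'` -/
def Steps (P : Params Sg) (m : Mode) : Tm Sg → Tm Sg → Prop :=
  Relation.ReflTransGen (Step P m)

/-- Compatibility `T₁ ∥ T₂`: equal up to refinements. -/
inductive Compat : Ty Sg → Ty Sg → Prop where
  | refine (B : Sg.Base) (e₁ e₂ : Tm Sg) : Compat (.refine B e₁) (.refine B e₂)
  | arrow {T₁₁ T₁₂ T₂₁ T₂₂ : Ty Sg} : Compat T₁₁ T₂₁ → Compat T₁₂ T₂₂ →
      Compat (.arrow T₁₁ T₁₂) (.arrow T₂₁ T₂₂)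

/-- Which programs a typing derivation may speak about: all run-time terms, or source programs
only. In a source program a constant `k` has type `{x:ty(k) | true}`, casts are annotated `•` and
have a nonempty label, and there are neither active checks nor blame. -/
inductive Kind : Type where
  | runtime
  | source

/- Well-formed contexts `⊢ Γ`, types `⊢ T` and annotations `⊢ a ∥ T₁ ⇒ T₂`, and typing
`Γ ⊢ e : T`, in mode `m`. -/
mutual
inductive WfCtx (P : Params Sg) : Mode → Kind → List (Ty Sg) → Prop where
  | empty {m : Mode} {s : Kind} : WfCtx P m s []
  | extend {m : Mode} {s : Kind} {Γ : List (Ty Sg)} {T : Ty Sg} :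
      WfCtx P m s Γ → WfTy P m s T → WfCtx P m s (T :: Γ)
inductive WfTy (P : Params Sg) : Mode → Kind → Ty Sg → Prop where
  | base {m : Mode} {s : Kind} (B : Sg.Base) : WfTy P m s (.triv B)
  | refine {m : Mode} {s : Kind} {B : Sg.Base} {e : Tm Sg} :
      HasTy P m s [.triv B] e (.triv Sg.bool) → WfTy P m s (.refine B e)
  | arrow {m : Mode} {s : Kind} {T₁ T₂ : Ty Sg} :
      WfTy P m s T₁ → WfTy P m s T₂ → WfTy P m s (.arrow T₁ T₂)
inductive WfAnn (P : Params Sg) : Mode → Kind → Ann Sg → Ty Sg → Ty Sg → Prop where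
  | none {m : Mode} {s : Kind} {T₁ T₂ : Ty Sg} :
      WfTy P m s T₁ → WfTy P m s T₂ → Compat T₁ T₂ → WfAnn P m s .none T₁ T₂
  | typeSet {S : Finset (Ty Sg)} {T₁ T₂ : Ty Sg} :
      WfTy P .heedful .runtime T₁ → WfTy P .heedful .runtime T₂ → Compat T₁ T₂ →
      (∀ T ∈ S, WfTy P .heedful .runtime T) → (∀ T ∈ S, Compat T T₁) →
      WfAnn P .heedful .runtime (.ofFinset S) T₁ T₂
inductive HasTy (P : Params Sg) : Mode → Kind → List (Ty Sg) → Tm Sg → Ty Sg → Prop where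
  | var {m : Mode} {s : Kind} {Γ : List (Ty Sg)} {x : ℕ} {T : Ty Sg} :
      WfCtx P m s Γ → Γ[x]? = some T → HasTy P m s Γ (.var x) T
  | const {m : Mode} {s : Kind} {Γ : List (Ty Sg)} {k : Sg.Const} {e : Tm Sg} :
      WfCtx P m s Γ → WfTy P m s (.refine (Sg.ty k) e) →
      Steps P m (e.inst (.const k)) (.const Sg.tt) →
      (s = .source → e = .const Sg.tt) →
      HasTy P m s Γ (.const k) (.refine (Sg.ty k) e)
  | lam {m : Mode} {s : Kind} {Γ : List (Ty Sg)} {T₁ T₂ : Ty Sg} {e : Tm Sg} :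
      WfTy P m s T₁ → HasTy P m s (T₁ :: Γ) e T₂ →
      HasTy P m s Γ (.lam T₁ e) (.arrow T₁ T₂)
  | app {m : Mode} {s : Kind} {Γ : List (Ty Sg)} {T₁ T₂ : Ty Sg} {e₁ e₂ : Tm Sg} :
      HasTy P m s Γ e₁ (.arrow T₁ T₂) → HasTy P m s Γ e₂ T₁ →
      HasTy P m s Γ (.app e₁ e₂) T₂
  | op {m : Mode} {s : Kind} {Γ : List (Ty Sg)} {o : Sg.Op} {es : Fin (Sg.arity o) → Tm Sg} :
      WfCtx P m s Γ →
      (∀ i, HasTy P m s Γ (es i) (.refine (P.argBase o i) (P.argPred o i))) →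
      HasTy P m s Γ (.op o es) (.refine (P.resBase o) (P.resPred o))
  | cast {m : Mode} {s : Kind} {Γ : List (Ty Sg)} {T₁ T₂ : Ty Sg} {a : Ann Sg}
      {l : Option Sg.Label} {e : Tm Sg} :
      HasTy P m s Γ e T₁ → WfAnn P m s a T₁ T₂ → (s = .source → l ≠ none) →
      HasTy P m s Γ (.cast T₁ a T₂ l e) T₂
  | blame {m : Mode} {Γ : List (Ty Sg)} {T : Ty Sg} {l : Option Sg.Label} :
      WfCtx P m .runtime Γ → WfTy P m .runtime T → HasTy P m .runtime Γ (.blame l) T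
  | check {m : Mode} {Γ : List (Ty Sg)} {e₁ e₂ : Tm Sg} {k : Sg.Const} {l : Option Sg.Label} :
      WfCtx P m .runtime Γ → WfTy P m .runtime (.refine (Sg.ty k) e₁) →
      HasTy P m .runtime [] e₂ (.triv Sg.bool) →
      Steps P m (e₁.inst (.const k)) e₂ →
      HasTy P m .runtime Γ (.check (Sg.ty k) e₁ e₂ k l) (.refine (Sg.ty k) e₁)
end

/-- The standing assumptions on primitive operations in mode `m`: their types are well formed, an
operation is defined on constants of the right base types exactly when these satisfy the argument
refinements, and its results satisfy the result refinement. -/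
def OpsSound (P : Params Sg) (m : Mode) : Prop :=
  ∀ o : Sg.Op,
    (∀ i, WfTy P m .runtime (.refine (P.argBase o i) (P.argPred o i))) ∧
    WfTy P m .runtime (.refine (P.resBase o) (P.resPred o)) ∧
    ∀ ks : Fin (Sg.arity o) → Sg.Const, (∀ i, Sg.ty (ks i) = P.argBase o i) →
      ((Sg.denote o ks).isSome ↔
        ∀ i, Steps P m ((P.argPred o i).inst (.const (ks i))) (.const Sg.tt)) ∧
      ∀ k, Sg.denote o ks = some k →
        Sg.ty k = P.resBase o ∧ Steps P m ((P.resPred o).inst (.const k)) (.const Sg.tt)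

/-- Closed term relation `e₁ ≃ e₂` over a value relation `R`: `e₁` runs in the classic mode, `e₂`
in the heedful mode, and either both raise blame, with possibly different labels, or both evaluate
to related values. -/
def ResultRel (P : Params Sg) (R : Tm Sg → Tm Sg → Prop) (e₁ e₂ : Tm Sg) : Prop :=
  ((∃ l, Steps P .classic e₁ (.blame l)) ∧ (∃ l', Steps P .heedful e₂ (.blame l'))) ∨
  ∃ v₁ v₂, Val .classic v₁ ∧ Val .heedful v₂ ∧
    Steps P .classic e₁ v₁ ∧ Steps P .heedful e₂ v₂ ∧ R v₁ v₂

/-- Closed value relation `v₁ ∼ v₂ : T` between classic and heedful values. At function types the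
heedful value is well typed at the index. -/
def ValRel (P : Params Sg) : Ty Sg → Tm Sg → Tm Sg → Prop
  | .refine B e, v₁, v₂ => ∃ k : Sg.Const, v₁ = .const k ∧ v₂ = .const k ∧ Sg.ty k = B ∧
      Steps P .heedful (e.inst (.const k)) (.const Sg.tt)
  | .arrow T₁ T₂, v₁, v₂ => Val .classic v₁ ∧ Val .heedful v₂ ∧
      HasTy P .heedful .runtime [] v₂ (.arrow T₁ T₂) ∧
      ∀ w₁ w₂, ValRel P T₁ w₁ w₂ → ResultRel P (ValRel P T₂) (.app v₁ w₁) (.app v₂ w₂)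

/-- `e₁ ≃ e₂ : T` for closed terms -/
def TermRel (P : Params Sg) (T : Ty Sg) (e₁ e₂ : Tm Sg) : Prop :=
  ResultRel P (ValRel P T) e₁ e₂

/-- `T₁ ∼ T₂` for types -/
def TyRel (P : Params Sg) : Ty Sg → Ty Sg → Prop
  | .refine B₁ e₁, .refine B₂ e₂ => B₁ = B₂ ∧
      ∀ w₁ w₂, ValRel P (.triv B₁) w₁ w₂ →
        TermRel P (.triv Sg.bool) (e₁.inst w₁) (e₂.inst w₂)
  | .arrow T₁₁ T₁₂, .arrow T₂₁ T₂₂ => TyRel P T₁₁ T₂₁ ∧ TyRel P T₁₂ T₂₂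
  | _, _ => False

/-- `Γ ⊨ δ` for the dual substitution `δ = (δ₁, δ₂)` -/
def CtxRel (P : Params Sg) (Γ : List (Ty Sg)) (δ₁ δ₂ : ℕ → Tm Sg) : Prop :=
  ∀ x T, Γ[x]? = some T → ValRel P T (δ₁ x) (δ₂ x)

/-- `Γ ⊢ e₁ ≃ e₂ : T` for open terms -/
def OpenRel (P : Params Sg) (Γ : List (Ty Sg)) (e₁ e₂ : Tm Sg) (T : Ty Sg) : Prop :=
  ∀ δ₁ δ₂ : ℕ → Tm Sg, CtxRel P Γ δ₁ δ₂ → TermRel P T (e₁.subst δ₁) (e₂.subst δ₂)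

end

/-!
The classic and the heedful semantics differ in two ways: the heedful mode merges adjacent casts,
which reorders and deduplicates the checks on a constant, and it wraps a function only once, so that
applying a merged proxy runs merged casts where the classic mode runs nested ones. A logical
relation between the two modes is compatible with all source term formers once it is known that
merging is harmless, and this is where the work lies.

*Merging.* `Sim e e'` says that the heedful results of `e'` are results of `e`, up to labels.
`Sim.cast_steps` shows that evaluating the argument under a heedful cast first, and only then the
cast, agrees in this sense with the actual reduction, which may merge casts before the argument is
evaluated. The critical case is a cast of a constant, where the two reductions perform the same
checks in different orders (`checksAll_cast_const`). The outcome is independent of the order only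
because every single check terminates. `exists_unwrap` then describes the heedful cast of any
function value, proxy or not, as the expected wrapper. Merging drops the label of the inner proxy,
so this holds up to labels only; labels do not influence reduction (`LabEq.step`), and subject
reduction (`HasTy.steps`) keeps the relabelled values well typed, as the logical relation demands.

*Termination of checks.* Values related to one another may be heedful proxies carrying arbitrary
well-formed run-time types, so termination is needed for all of these and not just for source
types. `GoodTy` and `GoodTm` express termination hereditarily: all refinements that can ever be
checked halt. `HasTy.norm` is a normalization proof by a unary logical relation for good terms,
and uses `Sim.cast_steps` and `exists_unwrap`. An induction on typing derivations (`HasTy.goodTm`)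
then shows that every well-typed term is good, since the predicate of a well-formed refinement is
itself a typed term of smaller derivation.

*The relation.* With these facts, `Compat.castRel` relates a classic cast to the heedful one by
induction on the compatibility of its types, and `HasTy.termRel` is the fundamental lemma. The
statements about blame and values follow by determinism of reduction (`Step.det`).
-/

section

open Classical

variable {Sg : Signature} {P : Params Sg}

/-! ### Renaming and substitution -/

namespace Tm

/-- The substitution sending index `0` to `v` and index `n + 1` to `s n`. -/
def scons (v : Tm Sg) (s : ℕ → Tm Sg) : ℕ → Tm Sg
  | 0 => v
  | n + 1 => s n

theorem inst_eq_subst (e v : Tm Sg) : e.inst v = e.subst (scons v .var) := by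
  unfold Tm.inst
  congr 1

theorem liftSubst_rename (f : ℕ → ℕ) (s : ℕ → Tm Sg) :
    (fun n => liftSubst s (liftRen f n)) = liftSubst (fun n => s (f n)) := by
  funext n; cases n <;> rfl

theorem subst_rename : ∀ (e : Tm Sg) (f : ℕ → ℕ) (s : ℕ → Tm Sg),
    (e.rename f).subst s = e.subst (fun n => s (f n))
  | .var n, f, s => rfl
  | .const k, f, s => rfl
  | .lam T e, f, s => by
      simp only [rename, subst]
      rw [subst_rename e, liftSubst_rename]
  | .app e₁ e₂, f, s => by
      simp only [rename, subst]
      rw [subst_rename e₁, subst_rename e₂]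
  | .op o es, f, s => by
      simp only [rename, subst]
      congr 1; funext i; exact subst_rename (es i) f s
  | .cast T₁ a T₂ l e, f, s => by
      simp only [rename, subst]
      rw [subst_rename e]
  | .check B e₁ e₂ k l, f, s => by
      simp only [rename, subst]
      rw [subst_rename e₂]
  | .blame l, f, s => rfl

theorem rename_rename : ∀ (e : Tm Sg) (f g : ℕ → ℕ),
    (e.rename f).rename g = e.rename (fun n => g (f n))
  | .var n, f, g => rfl
  | .const k, f, g => rfl
  | .lam T e, f, g => by
      simp only [rename]
      rw [rename_rename e]
      congr 2; funext n; cases n <;> rfl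
  | .app e₁ e₂, f, g => by
      simp only [rename]
      rw [rename_rename e₁, rename_rename e₂]
  | .op o es, f, g => by
      simp only [rename]
      congr 1; funext i; exact rename_rename (es i) f g
  | .cast T₁ a T₂ l e, f, g => by
      simp only [rename]
      rw [rename_rename e]
  | .check B e₁ e₂ k l, f, g => by
      simp only [rename]
      rw [rename_rename e₂]
  | .blame l, f, g => rfl

theorem rename_subst : ∀ (e : Tm Sg) (s : ℕ → Tm Sg) (g : ℕ → ℕ),
    (e.subst s).rename g = e.subst (fun n => (s n).rename g)
  | .var n, s, g => rfl
  | .const k, s, g => rfl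
  | .lam T e, s, g => by
      simp only [rename, subst]
      rw [rename_subst e]
      congr 2; funext n
      cases n with
      | zero => rfl
      | succ n =>
        simp only [liftSubst, rename_rename]
        rfl
  | .app e₁ e₂, s, g => by
      simp only [rename, subst]
      rw [rename_subst e₁, rename_subst e₂]
  | .op o es, s, g => by
      simp only [rename, subst]
      congr 1; funext i; exact rename_subst (es i) s g
  | .cast T₁ a T₂ l e, s, g => by
      simp only [rename, subst]
      rw [rename_subst e]
  | .check B e₁ e₂ k l, s, g => by
      simp only [rename, subst]
      rw [rename_subst e₂]
  | .blame l, s, g => rfl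

theorem subst_subst : ∀ (e : Tm Sg) (s t : ℕ → Tm Sg),
    (e.subst s).subst t = e.subst (fun n => (s n).subst t)
  | .var n, s, t => rfl
  | .const k, s, t => rfl
  | .lam T e, s, t => by
      simp only [subst]
      rw [subst_subst e]
      congr 2; funext n
      cases n with
      | zero => rfl
      | succ n =>
        simp only [liftSubst, subst_rename, rename_subst]
  | .app e₁ e₂, s, t => by
      simp only [subst]
      rw [subst_subst e₁, subst_subst e₂]
  | .op o es, s, t => by
      simp only [subst]
      congr 1; funext i; exact subst_subst (es i) s t
  | .cast T₁ a T₂ l e, s, t => by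
      simp only [subst]
      rw [subst_subst e]
  | .check B e₁ e₂ k l, s, t => by
      simp only [subst]
      rw [subst_subst e₂]
  | .blame l, s, t => rfl

theorem liftSubst_var : liftSubst (Tm.var : ℕ → Tm Sg) = .var := by
  funext n; cases n <;> rfl

theorem subst_var : ∀ e : Tm Sg, e.subst .var = e
  | .var n => rfl
  | .const k => rfl
  | .lam T e => by simp only [subst]; rw [liftSubst_var, subst_var e]
  | .app e₁ e₂ => by simp only [subst]; rw [subst_var e₁, subst_var e₂]
  | .op o es => by
      simp only [subst]
      congr 1; funext i; exact subst_var (es i)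
  | .cast T₁ a T₂ l e => by simp only [subst]; rw [subst_var e]
  | .check B e₁ e₂ k l => by simp only [subst]; rw [subst_var e₂]
  | .blame l => rfl

/-- Contracting a beta-redex whose body was substituted under its binder. -/
theorem inst_subst_liftSubst (e v : Tm Sg) (s : ℕ → Tm Sg) :
    (e.subst (liftSubst s)).inst v = e.subst (scons v s) := by
  rw [inst_eq_subst, subst_subst]
  congr 1; funext n
  cases n with
  | zero => rfl
  | succ n =>
    simp only [liftSubst, subst_rename]
    exact subst_var _

end Tm

/-! ### Typing: closed terms, weakening, substitution, regularity -/

theorem HasTy.subst_eq {m : Mode} {s : Kind} {Γ : List (Ty Sg)} {e : Tm Sg} {T : Ty Sg}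
    (h : HasTy P m s Γ e T) :
    ∀ σ : ℕ → Tm Sg, (∀ n < Γ.length, σ n = .var n) → e.subst σ = e := by
  refine HasTy.rec (motive_1 := fun _ _ _ _ => True) (motive_2 := fun _ _ _ _ => True)
    (motive_3 := fun _ _ _ _ _ _ => True)
    (motive_4 := fun _ _ Γ e _ _ => ∀ σ : ℕ → Tm Sg, (∀ n < Γ.length, σ n = .var n) →
      e.subst σ = e)
    ?empty ?extend ?base ?refine ?arrow ?none ?typeSet ?var ?const ?lam ?app ?op ?cast ?blame
    ?check h
  case var =>
    intro m s Γ x T _ hx _ σ hσ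
    exact hσ x (List.getElem?_eq_some_iff.1 hx).1
  case const => intros; rfl
  case lam =>
    intro m s Γ T₁ T₂ e _ _ _ ih σ hσ
    simp only [Tm.subst]
    rw [ih]
    intro n hn
    cases n with
    | zero => rfl
    | succ n => simp [Tm.liftSubst, hσ n (by simpa using hn), Tm.rename]
  case app =>
    intro m s Γ T₁ T₂ e₁ e₂ _ _ ih₁ ih₂ σ hσ
    simp only [Tm.subst]; rw [ih₁ σ hσ, ih₂ σ hσ]
  case op =>
    intro m s Γ o es _ _ _ ih σ hσ
    simp only [Tm.subst]
    congr 1; funext i; exact ih i σ hσ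
  case cast =>
    intro m s Γ T₁ T₂ a l e _ _ _ ih _ σ hσ
    simp only [Tm.subst]; rw [ih σ hσ]
  case blame => intros; rfl
  case check =>
    intro m Γ e₁ e₂ k l _ _ _ _ _ _ ih σ _
    simp only [Tm.subst]; rw [ih σ (by simp)]
  all_goals intros; trivial

theorem HasTy.subst_closed {m : Mode} {s : Kind} {e : Tm Sg} {T : Ty Sg}
    (h : HasTy P m s [] e T) (σ : ℕ → Tm Sg) : e.subst σ = e :=
  h.subst_eq σ (by simp)

namespace Tm

theorem rename_eq_subst (e : Tm Sg) (f : ℕ → ℕ) : e.rename f = e.subst (fun n => .var (f n)) := by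
  conv_lhs => rw [← subst_var (e.rename f)]
  rw [subst_rename]

end Tm

theorem HasTy.rename_closed {m : Mode} {s : Kind} {e : Tm Sg} {T : Ty Sg}
    (h : HasTy P m s [] e T) (f : ℕ → ℕ) : e.rename f = e := by
  rw [Tm.rename_eq_subst, h.subst_closed]

theorem HasTy.rename {m : Mode} {s : Kind} {Γ : List (Ty Sg)} {e : Tm Sg} {T : Ty Sg}
    (h : HasTy P m s Γ e T) :
    ∀ (Δ : List (Ty Sg)) (f : ℕ → ℕ), (∀ x U, Γ[x]? = some U → Δ[f x]? = some U) →
      WfCtx P m s Δ → HasTy P m s Δ (e.rename f) T := by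
  refine HasTy.rec (motive_1 := fun _ _ _ _ => True) (motive_2 := fun _ _ _ _ => True)
    (motive_3 := fun _ _ _ _ _ _ => True)
    (motive_4 := fun m s Γ e T _ => ∀ (Δ : List (Ty Sg)) (f : ℕ → ℕ),
      (∀ x U, Γ[x]? = some U → Δ[f x]? = some U) →
      WfCtx P m s Δ → HasTy P m s Δ (e.rename f) T)
    ?empty ?extend ?base ?refine ?arrow ?none ?typeSet ?var ?const ?lam ?app ?op ?cast ?blame
    ?check h
  case var =>
    intro m s Γ x T _ hx _ Δ f hf hΔ
    exact .var hΔ (hf _ _ hx)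
  case const =>
    intro m s Γ k e _ hw hs hk _ _ Δ f hf hΔ
    exact .const hΔ hw hs hk
  case lam =>
    intro m s Γ T₁ T₂ e hT _ _ ih Δ f hf hΔ
    refine .lam hT (ih _ _ ?_ (.extend hΔ hT))
    intro x U hx
    cases x with
    | zero => simpa [Tm.liftRen] using hx
    | succ x => simpa [Tm.liftRen] using hf x U (by simpa using hx)
  case app =>
    intro m s Γ T₁ T₂ e₁ e₂ _ _ ih₁ ih₂ Δ f hf hΔ
    exact .app (ih₁ Δ f hf hΔ) (ih₂ Δ f hf hΔ)
  case op =>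
    intro m s Γ o es _ _ _ ih Δ f hf hΔ
    exact .op hΔ (fun i => ih i Δ f hf hΔ)
  case cast =>
    intro m s Γ T₁ T₂ a l e _ ha hl ih _ Δ f hf hΔ
    exact .cast (ih Δ f hf hΔ) ha hl
  case blame =>
    intro m Γ T l _ hT _ _ Δ f hf hΔ
    exact .blame hΔ hT
  case check =>
    intro m Γ e₁ e₂ k l _ hT he hs _ _ ih Δ f _ hΔ
    simp only [Tm.rename]
    rw [he.rename_closed]
    exact .check hΔ hT he hs
  all_goals intros; trivial

theorem HasTy.subst {m : Mode} {s : Kind} {Γ : List (Ty Sg)} {e : Tm Sg} {T : Ty Sg}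
    (h : HasTy P m s Γ e T) :
    ∀ (Δ : List (Ty Sg)) (σ : ℕ → Tm Sg),
      (∀ x U, Γ[x]? = some U → HasTy P m s Δ (σ x) U) →
      WfCtx P m s Δ → HasTy P m s Δ (e.subst σ) T := by
  refine HasTy.rec (motive_1 := fun _ _ _ _ => True) (motive_2 := fun _ _ _ _ => True)
    (motive_3 := fun _ _ _ _ _ _ => True)
    (motive_4 := fun m s Γ e T _ => ∀ (Δ : List (Ty Sg)) (σ : ℕ → Tm Sg),
      (∀ x U, Γ[x]? = some U → HasTy P m s Δ (σ x) U) →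
      WfCtx P m s Δ → HasTy P m s Δ (e.subst σ) T)
    ?empty ?extend ?base ?refine ?arrow ?none ?typeSet ?var ?const ?lam ?app ?op ?cast ?blame
    ?check h
  case var =>
    intro m s Γ x T _ hx _ Δ σ hσ hΔ
    exact hσ _ _ hx
  case const =>
    intro m s Γ k e _ hw hs hk _ _ Δ σ hσ hΔ
    exact .const hΔ hw hs hk
  case lam =>
    intro m s Γ T₁ T₂ e hT _ _ ih Δ σ hσ hΔ
    have hΔ' : WfCtx P m s (T₁ :: Δ) := .extend hΔ hT
    refine .lam hT (ih _ _ ?_ hΔ')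
    intro x U hx
    cases x with
    | zero => exact .var hΔ' (by simpa using hx)
    | succ x => exact (hσ x U (by simpa using hx)).rename _ _ (by simp) hΔ'
  case app =>
    intro m s Γ T₁ T₂ e₁ e₂ _ _ ih₁ ih₂ Δ σ hσ hΔ
    exact .app (ih₁ Δ σ hσ hΔ) (ih₂ Δ σ hσ hΔ)
  case op =>
    intro m s Γ o es _ _ _ ih Δ σ hσ hΔ
    exact .op hΔ (fun i => ih i Δ σ hσ hΔ)
  case cast =>
    intro m s Γ T₁ T₂ a l e _ ha hl ih _ Δ σ hσ hΔ
    exact .cast (ih Δ σ hσ hΔ) ha hl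
  case blame =>
    intro m Γ T l _ hT _ _ Δ σ hσ hΔ
    exact .blame hΔ hT
  case check =>
    intro m Γ e₁ e₂ k l _ hT he hs _ _ ih Δ σ _ hΔ
    simp only [Tm.subst]
    rw [he.subst_closed]
    exact .check hΔ hT he hs
  all_goals intros; trivial

theorem HasTy.inst {m : Mode} {s : Kind} {e v : Tm Sg} {T₁ T₂ : Ty Sg}
    (h : HasTy P m s [T₁] e T₂) (hv : HasTy P m s [] v T₁) : HasTy P m s [] (e.inst v) T₂ := by
  rw [Tm.inst_eq_subst]
  refine h.subst _ _ ?_ .empty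
  intro x U hx
  cases x with
  | zero => simp only [List.getElem?_cons_zero, Option.some.injEq] at hx; exact hx ▸ hv
  | succ x => simp at hx

theorem wfCtx_getElem {m : Mode} {s : Kind} {T : Ty Sg} :
    ∀ {Γ : List (Ty Sg)} {x : ℕ}, WfCtx P m s Γ → Γ[x]? = some T → WfTy P m s T
  | [], _, _, h => by simp at h
  | U :: Γ, 0, h, hx => by
      cases h with
      | extend _ h => simp only [List.getElem?_cons_zero, Option.some.injEq] at hx; exact hx ▸ h
  | U :: Γ, x + 1, h, hx => by
      cases h with
      | extend h _ => exact wfCtx_getElem h (by simpa using hx)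

theorem WfTy.arrow_inv {m : Mode} {s : Kind} {T₁ T₂ : Ty Sg} (h : WfTy P m s (.arrow T₁ T₂)) :
    WfTy P m s T₁ ∧ WfTy P m s T₂ := by
  cases h with
  | arrow h₁ h₂ => exact ⟨h₁, h₂⟩

theorem Signature.ty_tt : Sg.ty Sg.tt = Sg.bool := (Sg.ty_eq_bool_iff _).2 (.inl rfl)

theorem hasTy_tt {m : Mode} {s : Kind} {Γ : List (Ty Sg)} (h : WfCtx P m s Γ) :
    HasTy P m s Γ (.const Sg.tt) (.triv Sg.bool) := by
  have := HasTy.const (k := Sg.tt) (e := .const Sg.tt) h (WfTy.base (P := P) _)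
    Relation.ReflTransGen.refl (fun _ => rfl)
  rwa [Signature.ty_tt] at this

theorem WfTy.refine_inv {m : Mode} {s : Kind} {B : Sg.Base} {e : Tm Sg}
    (h : WfTy P m s (.refine B e)) : HasTy P m s [.triv B] e (.triv Sg.bool) := by
  generalize hT : Ty.refine B e = T at h
  cases h with
  | base B' =>
    simp only [Ty.triv, Ty.refine.injEq] at hT
    obtain ⟨rfl, rfl⟩ := hT
    exact hasTy_tt (.extend .empty (.base _))
  | refine h => cases hT; exact h
  | arrow => cases hT

/-- The type of a well-typed run-time term is well formed. -/
theorem HasTy.wfTy {m : Mode} {Γ : List (Ty Sg)} {e : Tm Sg} {T : Ty Sg} (hops : OpsSound P m)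
    (h : HasTy P m .runtime Γ e T) : WfTy P m .runtime T := by
  refine HasTy.rec (motive_1 := fun _ _ _ _ => True) (motive_2 := fun _ _ _ _ => True)
    (motive_3 := fun _ _ _ _ _ _ => True)
    (motive_4 := fun m s Γ e T _ => OpsSound P m → s = .runtime → WfTy P m .runtime T)
    ?empty ?extend ?base ?refine ?arrow ?none ?typeSet ?var ?const ?lam ?app ?op ?cast ?blame
    ?check h hops rfl
  case var => rintro m s Γ x T hΓ hx _ _ rfl; exact wfCtx_getElem hΓ hx
  case const => rintro m s Γ k e _ hw _ _ _ _ _ rfl; exact hw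
  case lam => rintro m s Γ T₁ T₂ e hT _ _ ih ho rfl; exact .arrow hT (ih ho rfl)
  case app => rintro m s Γ T₁ T₂ e₁ e₂ _ _ ih _ ho rfl; exact (ih ho rfl).arrow_inv.2
  case op => rintro m s Γ o es _ _ _ _ ho rfl; exact (ho o).2.1
  case cast =>
    rintro m s Γ T₁ T₂ a l e _ ha _ _ _ _ rfl
    cases ha <;> assumption
  case blame => intros; assumption
  case check => intros; assumption
  all_goals intros; trivial

/-- Source programs are typed in the same way in both modes: their constants have only trivial
refinements, so no typing premise refers to reduction. -/
theorem HasTy.source_to_runtime {m m' : Mode} {Γ : List (Ty Sg)} {e : Tm Sg} {T : Ty Sg}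
    (h : HasTy P m .source Γ e T) : HasTy P m' .runtime Γ e T := by
  refine HasTy.rec
    (motive_1 := fun _ s Γ _ => s = .source → WfCtx P m' .runtime Γ)
    (motive_2 := fun _ s T _ => s = .source → WfTy P m' .runtime T)
    (motive_3 := fun _ s a T₁ T₂ _ => s = .source → WfAnn P m' .runtime a T₁ T₂)
    (motive_4 := fun _ s Γ e T _ => s = .source → HasTy P m' .runtime Γ e T)
    ?empty ?extend ?base ?refine ?arrow ?none ?typeSet ?var ?const ?lam ?app ?op ?cast ?blame
    ?check h rfl
  case empty => intros; exact .empty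
  case extend => intro m s Γ T _ _ h₁ h₂ hs; exact .extend (h₁ hs) (h₂ hs)
  case base => intros; exact .base _
  case refine => intro m s B e _ ih hs; exact .refine (ih hs)
  case arrow => intro m s T₁ T₂ _ _ h₁ h₂ hs; exact .arrow (h₁ hs) (h₂ hs)
  case none => intro m s T₁ T₂ _ _ hc h₁ h₂ hs; exact .none (h₁ hs) (h₂ hs) hc
  case typeSet => intro S T₁ T₂ _ _ _ _ _ _ _ _ hs; cases hs
  case var => intro m s Γ x T _ hx ih hs; exact .var (ih hs) hx
  case const =>
    intro m s Γ k e _ _ _ hk h₁ h₂ hs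
    obtain rfl := hk hs
    exact .const (h₁ hs) (h₂ hs) .refl (fun _ => rfl)
  case lam => intro m s Γ T₁ T₂ e _ _ h₁ h₂ hs; exact .lam (h₁ hs) (h₂ hs)
  case app => intro m s Γ T₁ T₂ e₁ e₂ _ _ h₁ h₂ hs; exact .app (h₁ hs) (h₂ hs)
  case op => intro m s Γ o es _ _ h₁ h₂ hs; exact .op (h₁ hs) (fun i => h₂ i hs)
  case cast => intro m s Γ T₁ T₂ a l e _ _ _ h₁ h₂ hs; exact .cast (h₁ hs) (h₂ hs) (by simp)
  case blame => intro m Γ T l _ _ _ _ hs; cases hs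
  case check => intro m Γ e₁ e₂ k l _ _ _ _ _ _ _ hs; cases hs

theorem WfTy.source_to_runtime {m m' : Mode} {T : Ty Sg} (h : WfTy P m .source T) :
    WfTy P m' .runtime T := by
  have : HasTy P m .source [T] (.var 0) T := .var (.extend .empty h) rfl
  exact wfCtx_getElem (x := 0) (Γ := [T])
    (by cases (this.source_to_runtime (m' := m')) with | var h _ => exact h) rfl

/-! ### Inversion of reduction and determinism -/

@[simp] theorem Ann.ofFinset_inj {S S' : Finset (Ty Sg)} :
    Ann.ofFinset S = Ann.ofFinset S' ↔ S = S' :=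
  Ann.ofFinset_injective.eq_iff

@[simp] theorem Ann.ofFinset_ne_none (S : Finset (Ty Sg)) : Ann.ofFinset S ≠ Ann.none := by
  intro h; unfold Ann.ofFinset at h; cases h

@[simp] theorem Ann.none_ne_ofFinset (S : Finset (Ty Sg)) : Ann.none ≠ Ann.ofFinset S :=
  (Ann.ofFinset_ne_none S).symm

@[simp] theorem mergeable_cast_ofFinset (T₁ T₂ : Ty Sg) (S : Finset (Ty Sg))
    (l : Option Sg.Label) (e : Tm Sg) : Mergeable (.cast T₁ (.ofFinset S) T₂ l e) :=
  ⟨T₁, T₂, S, l, e, rfl⟩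

@[simp] theorem not_mergeable_const (k : Sg.Const) : ¬ Mergeable (.const k) := by
  rintro ⟨_, _, _, _, _, h⟩; cases h

@[simp] theorem not_mergeable_lam (T : Ty Sg) (e : Tm Sg) : ¬ Mergeable (.lam T e) := by
  rintro ⟨_, _, _, _, _, h⟩; cases h

@[simp] theorem not_mergeable_blame (l : Option Sg.Label) : ¬ Mergeable (.blame l) := by
  rintro ⟨_, _, _, _, _, h⟩; cases h

@[simp] theorem not_mergeable_app (e₁ e₂ : Tm Sg) : ¬ Mergeable (.app e₁ e₂) := by
  rintro ⟨_, _, _, _, _, h⟩; cases h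

@[simp] theorem not_mergeable_check (B : Sg.Base) (e₁ e₂ : Tm Sg) (k : Sg.Const)
    (l : Option Sg.Label) : ¬ Mergeable (.check B e₁ e₂ k l) := by
  rintro ⟨_, _, _, _, _, h⟩; cases h

theorem RunAnn.heedful_inv {a : Ann Sg} (h : RunAnn .heedful a) : ∃ S, a = .ofFinset S := by
  cases h with
  | heedful S => exact ⟨S, rfl⟩

/-- Inversion of reduction at a cast, with an arbitrary annotation in place of the images of
`Ann.ofFinset` that index the constructors. -/
theorem Step.cast_inv {m : Mode} {T₁ T₂ : Ty Sg} {a : Ann Sg} {l : Option Sg.Label} {e r : Tm Sg}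
    (h : Step P m (.cast T₁ a T₂ l e) r) :
    (m = .classic ∧ a = .none ∧ ∃ B e₁ e₂ k, T₁ = .refine B e₁ ∧ T₂ = .refine B e₂ ∧
      e = .const k ∧ r = .check B e₂ (e₂.inst (.const k)) k l) ∨
    (m = .heedful ∧ a = .none ∧ r = .cast T₁ (.ofFinset ∅) T₂ l e) ∨
    (m = .heedful ∧ a = .ofFinset ∅ ∧ ∃ B e₁ e₂ k, T₁ = .refine B e₁ ∧ T₂ = .refine B e₂ ∧
      e = .const k ∧ r = .check B e₂ (e₂.inst (.const k)) k l) ∨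
    (m = .heedful ∧ ∃ S B e₁ e₂ e₃ k, a = .ofFinset S ∧ S.Nonempty ∧ P.choose S = .refine B e₂ ∧
      T₁ = .refine B e₁ ∧ T₂ = .refine B e₃ ∧ e = .const k ∧
      r = .cast (.refine B e₂) (.ofFinset (S.erase (.refine B e₂))) (.refine B e₃) l
          (.check B e₂ (e₂.inst (.const k)) k l)) ∨
    (m = .heedful ∧ ∃ S₂ T₀ S₁ l₁ e₀, a = .ofFinset S₂ ∧
      e = .cast T₀ (.ofFinset S₁) T₁ l₁ e₀ ∧
      r = .cast T₀ (.ofFinset (S₁ ∪ S₂ ∪ {T₁})) T₂ l e₀) ∨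
    (RunAnn m a ∧ (m = .heedful → ¬ Mergeable e) ∧ ∃ e', Step P m e e' ∧
      r = .cast T₁ a T₂ l e') ∨
    (RunAnn m a ∧ ∃ l', e = .blame l' ∧ r = .blame l') := by
  cases h with
  | checkNone => exact .inl ⟨rfl, rfl, _, _, _, _, rfl, rfl, rfl, rfl⟩
  | typeSet => exact .inr (.inl ⟨rfl, rfl, rfl⟩)
  | checkEmpty => exact .inr (.inr (.inl ⟨rfl, rfl, _, _, _, _, rfl, rfl, rfl, rfl⟩))
  | checkSet h₁ h₂ =>
    exact .inr (.inr (.inr (.inl ⟨rfl, _, _, _, _, _, _, rfl, h₁, h₂, rfl, rfl, rfl, rfl⟩)))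
  | castMerge =>
    exact .inr (.inr (.inr (.inr (.inl ⟨rfl, _, _, _, _, _, rfl, rfl, rfl⟩))))
  | castInner h₁ h₂ h₃ =>
    exact .inr (.inr (.inr (.inr (.inr (.inl ⟨h₁, h₂, _, h₃, rfl⟩)))))
  | castRaise h₁ =>
    exact .inr (.inr (.inr (.inr (.inr (.inr ⟨h₁, _, rfl, rfl⟩)))))

theorem Step.check_inv {m : Mode} {B : Sg.Base} {e₁ e : Tm Sg} {k : Sg.Const}
    {l : Option Sg.Label} {r : Tm Sg} (h : Step P m (.check B e₁ e k l) r) :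
    (e = .const Sg.tt ∧ r = .const k) ∨ (e = .const Sg.ff ∧ r = .blame l) ∨
    (∃ e', Step P m e e' ∧ r = .check B e₁ e' k l) ∨ (∃ l', e = .blame l' ∧ r = .blame l') := by
  cases h with
  | checkOK => exact .inl ⟨rfl, rfl⟩
  | checkFail => exact .inr (.inl ⟨rfl, rfl⟩)
  | checkInner h => exact .inr (.inr (.inl ⟨_, h, rfl⟩))
  | checkRaise => exact .inr (.inr (.inr ⟨_, rfl, rfl⟩))

theorem Step.op_inv {m : Mode} {o : Sg.Op} {es : Fin (Sg.arity o) → Tm Sg} {r : Tm Sg}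
    (h : Step P m (.op o es) r) :
    (∃ ks k, es = (fun i => .const (ks i)) ∧ Sg.denote o ks = some k ∧ r = .const k) ∨
    (∃ i e', (∀ j < i, Val m (es j)) ∧ Step P m (es i) e' ∧
      r = .op o (Function.update es i e')) ∨
    (∃ i l, (∀ j < i, Val m (es j)) ∧ es i = .blame l ∧ r = .blame l) := by
  cases h with
  | op h => exact .inl ⟨_, _, rfl, h, rfl⟩
  | opInner h₁ h₂ => exact .inr (.inl ⟨_, _, h₁, h₂, rfl⟩)
  | opRaise h₁ h₂ => exact .inr (.inr ⟨_, _, h₁, h₂, rfl⟩)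

@[simp] theorem Step.const_iff {m : Mode} {k : Sg.Const} {r : Tm Sg} :
    Step P m (.const k) r ↔ False := by
  refine ⟨fun h => ?_, False.elim⟩; cases h

@[simp] theorem Step.blame_iff {m : Mode} {l : Option Sg.Label} {r : Tm Sg} :
    Step P m (.blame l) r ↔ False := by
  refine ⟨fun h => ?_, False.elim⟩; cases h

@[simp] theorem Step.lam_iff {m : Mode} {T : Ty Sg} {e r : Tm Sg} :
    Step P m (.lam T e) r ↔ False := by
  refine ⟨fun h => ?_, False.elim⟩; cases h

theorem not_val_blame {m : Mode} {l : Option Sg.Label} : ¬ Val m (.blame l : Tm Sg) := by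
  intro h; cases h

theorem Val.not_step {m : Mode} {v : Tm Sg} (hv : Val m v) : ∀ r, ¬ Step P m v r := by
  induction hv with
  | const => simp
  | lam => simp
  | proxyC h ih =>
    intro r hr
    rcases hr.cast_inv with h | h | h | h | h | h | h <;> try simp_all
    obtain ⟨_, _, rfl, _⟩ := h
    exact not_val_blame ‹_›
  | proxyH =>
    intro r hr
    rcases hr.cast_inv with h | h | h | h | h | h | h <;> try simp_all

theorem AnnDom.det {a b c : Ann Sg} (h : AnnDom a b) (h' : AnnDom a c) : b = c := by
  cases h with
  | none => generalize ha : Ann.none = a at h'; cases h' <;> try simp_all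
  | set S => generalize ha : Ann.ofFinset S = a at h'; cases h' <;> try simp_all

theorem AnnCod.det {a b c : Ann Sg} (h : AnnCod a b) (h' : AnnCod a c) : b = c := by
  cases h with
  | none => generalize ha : Ann.none = a at h'; cases h' <;> try simp_all
  | set S => generalize ha : Ann.ofFinset S = a at h'; cases h' <;> try simp_all

/-- The position at which left-to-right evaluation of arguments acts is unique. -/
theorem first_nonvalue_unique {n : ℕ} {m : Mode} {es : Fin n → Tm Sg} {i j : Fin n}
    (hi : ∀ x < i, Val m (es x)) (hj : ∀ x < j, Val m (es x))
    (hi' : ¬ Val m (es i)) (hj' : ¬ Val m (es j)) : i = j :=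
  le_antisymm (not_lt.1 fun h => hj' (hi j h)) (not_lt.1 fun h => hi' (hj i h))

theorem Step.det {m : Mode} {e e₁ e₂ : Tm Sg} (h₁ : Step P m e e₁) (h₂ : Step P m e e₂) :
    e₁ = e₂ := by
  induction h₁ generalizing e₂ with
  | beta hv =>
    cases h₂ with
    | beta => rfl
    | appL h => simp at h
    | appR _ h => exact (hv.not_step _ h).elim
    | appRaiseR => exact (not_val_blame hv).elim
  | op h =>
    rcases h₂.op_inv with ⟨ks, k, he, hd, rfl⟩ | ⟨i, e', _, hs, _⟩ | ⟨i, l, _, hs, _⟩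
    · have : ks = _ := funext fun i => (Tm.const.inj (congrFun he i)).symm
      subst this
      rw [h] at hd
      rw [Option.some.inj hd]
    · simp at hs
    · simp at hs
  | unwrap hv hv' hd hc =>
    cases h₂ with
    | unwrap _ _ hd' hc' => rw [hd.det hd', hc.det hc']
    | appL h => exact (hv.not_step _ h).elim
    | appR _ h => exact (hv'.not_step _ h).elim
    | appRaiseR => exact (not_val_blame hv').elim
  | checkNone => rcases h₂.cast_inv with h | h | h | h | h | h | h <;> try simp_all
  | typeSet =>
    rcases h₂.cast_inv with h | h | h | h | h | h | h <;> try simp_all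
    · obtain ⟨S, hS⟩ := h.1.heedful_inv; simp at hS
    · obtain ⟨S, hS⟩ := h.1.heedful_inv; simp at hS
  | checkEmpty =>
    rcases h₂.cast_inv with h | h | h | h | h | h | h <;> try simp_all
  | checkSet hS hc =>
    rcases h₂.cast_inv with h | h | h | h | h | h | h <;> try simp_all
  | castMerge =>
    rcases h₂.cast_inv with h | h | h | h | h | h | h <;> try simp_all
  | checkOK =>
    rcases h₂.check_inv with ⟨_, rfl⟩ | ⟨h, _⟩ | ⟨_, h, _⟩ | ⟨_, h, _⟩
    · rfl
    · exact (Sg.tt_ne_ff (Tm.const.inj h)).elim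
    · simp at h
    · cases h
  | checkFail =>
    rcases h₂.check_inv with ⟨h, _⟩ | ⟨_, rfl⟩ | ⟨_, h, _⟩ | ⟨_, h, _⟩
    · exact (Sg.tt_ne_ff (Tm.const.inj h).symm).elim
    · rfl
    · simp at h
    · cases h
  | appL h ih =>
    cases h₂ with
    | beta => simp at h
    | unwrap hv => exact (hv.not_step _ h).elim
    | appL h' => rw [ih h']
    | appR hv => exact (hv.not_step _ h).elim
    | appRaiseL => simp at h
    | appRaiseR hv => exact (hv.not_step _ h).elim
  | appR hv h ih =>
    cases h₂ with
    | beta hv' => exact (hv'.not_step _ h).elim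
    | unwrap _ hv' => exact (hv'.not_step _ h).elim
    | appL h' => exact (hv.not_step _ h').elim
    | appR _ h' => rw [ih h']
    | appRaiseL => exact (not_val_blame hv).elim
    | appRaiseR => simp at h
  | opInner hi h ih =>
    rcases h₂.op_inv with ⟨ks, k, rfl, hd, rfl⟩ | ⟨j, e', hj, hs, rfl⟩ | ⟨j, l, hj, hs, rfl⟩
    · simp at h
    · obtain rfl := first_nonvalue_unique hi hj (fun hv => hv.not_step _ h)
        (fun hv => hv.not_step _ hs)
      rw [ih hs]
    · obtain rfl := first_nonvalue_unique hi hj (fun hv => hv.not_step _ h)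
        (fun hv => not_val_blame (hs ▸ hv))
      simp [hs] at h
  | castInner ha hm h ih =>
    rcases h₂.cast_inv with h' | h' | h' | h' | h' | h' | h'
    · obtain ⟨_, _, _, _, _, _, _, _, rfl, _⟩ := h'
      simp at h
    · obtain ⟨rfl, rfl, _⟩ := h'
      obtain ⟨S, hS⟩ := ha.heedful_inv
      simp at hS
    · obtain ⟨_, _, _, _, _, _, _, _, rfl, _⟩ := h'
      simp at h
    · obtain ⟨_, _, _, _, _, _, _, _, _, _, _, _, rfl, _⟩ := h'
      simp at h
    · obtain ⟨rfl, _, _, _, _, _, _, rfl, _⟩ := h'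
      simp at hm
    · obtain ⟨_, _, _, h', rfl⟩ := h'
      rw [ih h']
    · obtain ⟨_, _, rfl, _⟩ := h'
      simp at h
  | checkInner h ih =>
    cases h₂ with
    | checkOK => simp at h
    | checkFail => simp at h
    | checkInner h' => rw [ih h']
    | checkRaise => simp at h
  | appRaiseL =>
    cases h₂ with
    | appL h => simp at h
    | appR hv => exact (not_val_blame hv).elim
    | appRaiseL => rfl
    | appRaiseR hv => exact (not_val_blame hv).elim
  | appRaiseR hv =>
    cases h₂ with
    | beta hv => exact (not_val_blame hv).elim
    | unwrap _ hv => exact (not_val_blame hv).elim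
    | appL h => exact (hv.not_step _ h).elim
    | appR _ h => simp at h
    | appRaiseL => exact (not_val_blame hv).elim
    | appRaiseR => rfl
  | opRaise hi h =>
    rcases h₂.op_inv with ⟨ks, k, rfl, hd, rfl⟩ | ⟨j, e', hj, hs, rfl⟩ | ⟨j, l, hj, hs, rfl⟩
    · simp at h
    · obtain rfl := first_nonvalue_unique hi hj (fun hv => not_val_blame (h ▸ hv))
        (fun hv => hv.not_step _ hs)
      simp [h] at hs
    · obtain rfl := first_nonvalue_unique hi hj (fun hv => not_val_blame (h ▸ hv))
        (fun hv => not_val_blame (hs ▸ hv))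
      rw [h] at hs
      exact hs
  | castRaise ha =>
    rcases h₂.cast_inv with h | h | h | h | h | h | h <;> try simp_all
    obtain ⟨rfl, rfl, _⟩ := h
    obtain ⟨S, hS⟩ := ha.heedful_inv
    simp at hS
  | checkRaise =>
    cases h₂ with
    | checkInner h => simp at h
    | checkRaise => rfl

/-- A result is a value or blame. -/
def Result (m : Mode) (r : Tm Sg) : Prop := Val m r ∨ ∃ l, r = .blame l

theorem Result.not_step {m : Mode} {r : Tm Sg} (h : Result m r) (r' : Tm Sg) :
    ¬ Step P m r r' := by
  rcases h with h | ⟨l, rfl⟩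
  · exact h.not_step r'
  · simp

theorem Val.result {m : Mode} {v : Tm Sg} (h : Val m v) : Result m v := .inl h

theorem Result.blame {m : Mode} (l : Option Sg.Label) : Result m (.blame l : Tm Sg) :=
  .inr ⟨l, rfl⟩

theorem Result.eq_of_steps {m : Mode} {r r' : Tm Sg} (h : Result m r) (hs : Steps P m r r') :
    r' = r := by
  rcases hs.cases_head with h' | ⟨c, hc, _⟩
  · exact h'.symm
  · exact (h.not_step _ hc).elim

/-- Evaluation to a result factors through every term on the way. -/
theorem Steps.factor {m : Mode} {e e' r : Tm Sg} (h : Steps P m e e') (hr : Steps P m e r)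
    (hres : Result m r) : Steps P m e' r := by
  induction h using Relation.ReflTransGen.head_induction_on with
  | refl => exact hr
  | head hs _ ih =>
    rcases hr.cases_head with rfl | ⟨c, hc, hcr⟩
    · exact (hres.not_step _ hs).elim
    · exact ih (hc.det hs ▸ hcr)

theorem Steps.result_unique {m : Mode} {e r r' : Tm Sg} (h : Steps P m e r) (hr : Result m r)
    (h' : Steps P m e r') (hr' : Result m r') : r = r' :=
  (hr.eq_of_steps (h.factor h' hr')).symm

/-! ### Evaluation in context -/

theorem Steps.appL {m : Mode} {e₁ e₁' e₂ : Tm Sg} (h : Steps P m e₁ e₁') :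
    Steps P m (.app e₁ e₂) (.app e₁' e₂) :=
  Relation.ReflTransGen.lift (fun e => Tm.app e e₂) (fun _ _ h => Step.appL h) _ _ h

theorem Steps.appR {m : Mode} {e₁ e₂ e₂' : Tm Sg} (hv : Val m e₁) (h : Steps P m e₂ e₂') :
    Steps P m (.app e₁ e₂) (.app e₁ e₂') :=
  Relation.ReflTransGen.lift (fun e => Tm.app e₁ e) (fun _ _ h => Step.appR hv h) _ _ h

theorem Steps.check {m : Mode} {B : Sg.Base} {e₁ e e' : Tm Sg} {k : Sg.Const}
    {l : Option Sg.Label} (h : Steps P m e e') :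
    Steps P m (.check B e₁ e k l) (.check B e₁ e' k l) :=
  Relation.ReflTransGen.lift (fun e => Tm.check B e₁ e k l) (fun _ _ h => Step.checkInner h) _ _ h

theorem Steps.app_blameL {m : Mode} {e₁ e₂ : Tm Sg} {l : Option Sg.Label}
    (h : Steps P m e₁ (.blame l)) : Steps P m (.app e₁ e₂) (.blame l) :=
  h.appL.tail .appRaiseL

theorem Steps.app_blameR {m : Mode} {e₁ e₂ : Tm Sg} {l : Option Sg.Label} (hv : Val m e₁)
    (h : Steps P m e₂ (.blame l)) : Steps P m (.app e₁ e₂) (.blame l) :=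
  (h.appR hv).tail (.appRaiseR hv)

theorem Steps.classic_cast {T₁ T₂ : Ty Sg} {l : Option Sg.Label} {e e' : Tm Sg}
    (h : Steps P .classic e e') :
    Steps P .classic (.cast T₁ .none T₂ l e) (.cast T₁ .none T₂ l e') :=
  Relation.ReflTransGen.lift (fun e => Tm.cast T₁ .none T₂ l e)
    (fun _ _ h => Step.castInner .classic (by simp) h) _ _ h

/-- An active check whose condition is `true` returns the constant. -/
theorem Steps.check_ok {m : Mode} {B : Sg.Base} {e₁ e : Tm Sg} {k : Sg.Const}
    {l : Option Sg.Label} (h : Steps P m e (.const Sg.tt)) :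
    Steps P m (.check B e₁ e k l) (.const k) :=
  h.check.tail .checkOK

theorem Steps.check_ff {m : Mode} {B : Sg.Base} {e₁ e : Tm Sg} {k : Sg.Const}
    {l : Option Sg.Label} (h : Steps P m e (.const Sg.ff)) :
    Steps P m (.check B e₁ e k l) (.blame l) :=
  h.check.tail .checkFail

theorem Steps.check_blame {m : Mode} {B : Sg.Base} {e₁ e : Tm Sg} {k : Sg.Const}
    {l l' : Option Sg.Label} (h : Steps P m e (.blame l')) :
    Steps P m (.check B e₁ e k l) (.blame l') :=
  h.check.tail .checkRaise

/-- Left-to-right evaluation of the first `n` arguments of an operation, all of them constants. -/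
theorem Steps.op_prefix {m : Mode} {o : Sg.Op} {es : Fin (Sg.arity o) → Tm Sg}
    {ks : Fin (Sg.arity o) → Sg.Const} (n : ℕ) (hn : n ≤ Sg.arity o)
    (h : ∀ j : Fin (Sg.arity o), j.1 < n → Steps P m (es j) (.const (ks j))) :
    Steps P m (.op o es) (.op o (fun j => if j.1 < n then .const (ks j) else es j)) := by
  induction n with
  | zero => simp only [Nat.not_lt_zero, if_false]; exact .refl
  | succ n ih =>
    refine (ih (by omega) (fun j hj => h j (by omega))).trans ?_
    set es' : Fin (Sg.arity o) → Tm Sg := fun j => if j.1 < n then .const (ks j) else es j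
    let i : Fin (Sg.arity o) := ⟨n, hn⟩
    have hval : ∀ j < i, Val m (es' j) := by
      intro j hj
      have : j.1 < n := hj
      simp only [es', this, if_true]
      exact .const _
    have key : ∀ e, Steps P m (es' i) e →
        Steps P m (.op o es') (.op o (Function.update es' i e)) := by
      intro e he
      induction he with
      | refl => rw [Function.update_eq_self]; exact .refl
      | tail _ hs ih =>
        refine ih.tail ?_
        have := Step.opInner (P := P) (m := m) (o := o) (i := i)
          (es := Function.update es' i _) (fun j hj => by
            rw [Function.update_of_ne hj.ne]; exact hval j hj)
          (by rw [Function.update_self]; exact hs)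
        simpa using this
    have hi : es' i = es i := by simp [es', i]
    have := key (.const (ks i)) (hi ▸ h i (Nat.lt_succ_self n))
    refine cast ?_ this
    congr 2
    funext j
    by_cases hj : j = i
    · subst hj; simp [i]
    · have hne : j.1 ≠ n := fun h => hj (Fin.ext h)
      rw [Function.update_of_ne hj]
      have : j.1 < n + 1 ↔ j.1 < n := by omega
      simp only [this, es']

theorem Steps.op_consts {m : Mode} {o : Sg.Op} {es : Fin (Sg.arity o) → Tm Sg}
    {ks : Fin (Sg.arity o) → Sg.Const} (h : ∀ j, Steps P m (es j) (.const (ks j))) :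
    Steps P m (.op o es) (.op o (fun j => .const (ks j))) := by
  have := Steps.op_prefix _ le_rfl (fun j _ => h j)
  simpa using this

theorem Steps.op_blame {m : Mode} {o : Sg.Op} {es : Fin (Sg.arity o) → Tm Sg}
    {ks : Fin (Sg.arity o) → Sg.Const} {i : Fin (Sg.arity o)} {l : Option Sg.Label}
    (h : ∀ j < i, Steps P m (es j) (.const (ks j))) (hi : Steps P m (es i) (.blame l)) :
    Steps P m (.op o es) (.blame l) := by
  refine (Steps.op_prefix (ks := ks) i.1 i.2.le (fun j hj => h j hj)).trans ?_
  set es' : Fin (Sg.arity o) → Tm Sg := fun j => if j.1 < i.1 then .const (ks j) else es j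
  have hval : ∀ j < i, Val m (es' j) := by
    intro j hj
    have : j.1 < i.1 := hj
    simp only [es', this, if_true]
    exact .const _
  have hi' : es' i = es i := by simp [es']
  rw [← hi'] at hi
  clear_value es'
  clear hi' h
  generalize he : es' i = e at hi
  induction hi using Relation.ReflTransGen.head_induction_on generalizing es' with
  | refl => exact .single (.opRaise hval he)
  | head hs _ ih =>
    refine .head (.opInner hval (he ▸ hs)) (ih _ (fun j hj => ?_) (by simp))
    rw [Function.update_of_ne hj.ne]; exact hval j hj

/-! ### Subject reduction in the heedful mode -/

theorem Compat.symm {T₁ T₂ : Ty Sg} (h : Compat T₁ T₂) : Compat T₂ T₁ := by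
  induction h with
  | refine B e₁ e₂ => exact .refine B e₂ e₁
  | arrow _ _ ih₁ ih₂ => exact .arrow ih₁ ih₂

theorem Compat.trans {T₁ T₂ T₃ : Ty Sg} (h : Compat T₁ T₂) (h' : Compat T₂ T₃) :
    Compat T₁ T₃ := by
  induction h generalizing T₃ with
  | refine B e₁ e₂ => cases h'; exact .refine _ _ _
  | arrow _ _ ih₁ ih₂ => cases h' with | arrow h₁ h₂ => exact .arrow (ih₁ h₁) (ih₂ h₂)

theorem Compat.dom {T U : Ty Sg} (h : Compat T U) : Compat T.dom U.dom := by
  cases h with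
  | refine => exact .refine _ _ _
  | arrow h _ => exact h

theorem Compat.cod {T U : Ty Sg} (h : Compat T U) : Compat T.cod U.cod := by
  cases h with
  | refine => exact .refine _ _ _
  | arrow _ h => exact h

theorem WfTy.dom {m : Mode} {s : Kind} {T : Ty Sg} (h : WfTy P m s T) : WfTy P m s T.dom := by
  cases T with
  | refine => exact h
  | arrow => exact h.arrow_inv.1

theorem WfTy.cod {m : Mode} {s : Kind} {T : Ty Sg} (h : WfTy P m s T) : WfTy P m s T.cod := by
  cases T with
  | refine => exact h
  | arrow => exact h.arrow_inv.2

theorem wfAnn_inv {a : Ann Sg} {T₁ T₂ : Ty Sg} (h : WfAnn P .heedful .runtime a T₁ T₂) :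
    WfTy P .heedful .runtime T₁ ∧ WfTy P .heedful .runtime T₂ ∧ Compat T₁ T₂ ∧
      ∀ S, a = .ofFinset S → ∀ T ∈ S, WfTy P .heedful .runtime T ∧ Compat T T₁ := by
  cases h with
  | none h₁ h₂ h₃ => exact ⟨h₁, h₂, h₃, by simp⟩
  | typeSet h₁ h₂ h₃ h₄ h₅ =>
    refine ⟨h₁, h₂, h₃, fun S hS T hT => ?_⟩
    rw [Ann.ofFinset_inj] at hS
    subst hS
    exact ⟨h₄ T hT, h₅ T hT⟩

theorem wfAnn_ofFinset_iff {S : Finset (Ty Sg)} {T₁ T₂ : Ty Sg} :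
    WfAnn P .heedful .runtime (.ofFinset S) T₁ T₂ ↔
    WfTy P .heedful .runtime T₁ ∧ WfTy P .heedful .runtime T₂ ∧ Compat T₁ T₂ ∧
      ∀ T ∈ S, WfTy P .heedful .runtime T ∧ Compat T T₁ := by
  constructor
  · intro h
    have := wfAnn_inv h
    exact ⟨this.1, this.2.1, this.2.2.1, this.2.2.2 S rfl⟩
  · rintro ⟨h₁, h₂, h₃, h₄⟩
    exact .typeSet h₁ h₂ h₃ (fun T hT => (h₄ T hT).1) (fun T hT => (h₄ T hT).2)

theorem WfAnn.dom {a ad : Ann Sg} {T₁₁ T₁₂ T₂₁ T₂₂ : Ty Sg}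
    (h : WfAnn P .heedful .runtime a (.arrow T₁₁ T₁₂) (.arrow T₂₁ T₂₂)) (hd : AnnDom a ad) :
    WfAnn P .heedful .runtime ad T₂₁ T₁₁ := by
  obtain ⟨h₁, h₂, h₃, h₄⟩ := wfAnn_inv h
  cases hd with
  | none => exact .none h₂.dom h₁.dom h₃.symm.dom
  | set S =>
    refine wfAnn_ofFinset_iff.2 ⟨h₂.dom, h₁.dom, h₃.symm.dom, fun T hT => ?_⟩
    obtain ⟨U, hU, rfl⟩ := Finset.mem_image.1 hT
    exact ⟨(h₄ S rfl U hU).1.dom, ((h₄ S rfl U hU).2.trans h₃).dom⟩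

theorem WfAnn.cod {a ac : Ann Sg} {T₁₁ T₁₂ T₂₁ T₂₂ : Ty Sg}
    (h : WfAnn P .heedful .runtime a (.arrow T₁₁ T₁₂) (.arrow T₂₁ T₂₂)) (hc : AnnCod a ac) :
    WfAnn P .heedful .runtime ac T₁₂ T₂₂ := by
  obtain ⟨h₁, h₂, h₃, h₄⟩ := wfAnn_inv h
  cases hc with
  | none => exact .none h₁.cod h₂.cod h₃.cod
  | set S =>
    refine wfAnn_ofFinset_iff.2 ⟨h₁.cod, h₂.cod, h₃.cod, fun T hT => ?_⟩
    obtain ⟨U, hU, rfl⟩ := Finset.mem_image.1 hT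
    exact ⟨(h₄ S rfl U hU).1.cod, ((h₄ S rfl U hU).2).cod⟩

theorem WfAnn.merge {S₁ S₂ : Finset (Ty Sg)} {T₁ T₂ T₃ : Ty Sg}
    (h : WfAnn P .heedful .runtime (.ofFinset S₁) T₁ T₂)
    (h' : WfAnn P .heedful .runtime (.ofFinset S₂) T₂ T₃) :
    WfAnn P .heedful .runtime (.ofFinset (S₁ ∪ S₂ ∪ {T₂})) T₁ T₃ := by
  obtain ⟨h₁, h₂, h₃, h₄⟩ := wfAnn_ofFinset_iff.1 h
  obtain ⟨h₁', h₂', h₃', h₄'⟩ := wfAnn_ofFinset_iff.1 h'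
  refine wfAnn_ofFinset_iff.2 ⟨h₁, h₂', h₃.trans h₃', fun T hT => ?_⟩
  rw [Finset.mem_union, Finset.mem_union, Finset.mem_singleton] at hT
  rcases hT with (hT | hT) | rfl
  · exact h₄ T hT
  · exact ⟨(h₄' T hT).1, (h₄' T hT).2.trans h₃.symm⟩
  · exact ⟨h₂, h₃.symm⟩

theorem HasTy.const_inv {m : Mode} {s : Kind} {Γ : List (Ty Sg)} {k : Sg.Const} {T : Ty Sg}
    (h : HasTy P m s Γ (.const k) T) :
    ∃ p, T = .refine (Sg.ty k) p ∧ Steps P m (p.inst (.const k)) (.const Sg.tt) := by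
  cases h with
  | const _ _ h _ => exact ⟨_, rfl, h⟩

theorem HasTy.const_refine_inv {m : Mode} {s : Kind} {Γ : List (Ty Sg)} {k : Sg.Const}
    {B : Sg.Base} {p : Tm Sg} (h : HasTy P m s Γ (.const k) (.refine B p)) :
    Sg.ty k = B ∧ Steps P m (p.inst (.const k)) (.const Sg.tt) := by
  obtain ⟨p', hT, hs⟩ := h.const_inv
  cases hT
  exact ⟨rfl, hs⟩

theorem HasTy.lam_inv {m : Mode} {s : Kind} {Γ : List (Ty Sg)} {T U : Ty Sg} {e : Tm Sg}
    (h : HasTy P m s Γ (.lam T e) U) :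
    ∃ T', U = .arrow T T' ∧ HasTy P m s (T :: Γ) e T' := by
  cases h with
  | lam _ h => exact ⟨_, rfl, h⟩

theorem HasTy.cast_inv {m : Mode} {s : Kind} {Γ : List (Ty Sg)} {T₁ T₂ U : Ty Sg} {a : Ann Sg}
    {l : Option Sg.Label} {e : Tm Sg} (h : HasTy P m s Γ (.cast T₁ a T₂ l e) U) :
    U = T₂ ∧ HasTy P m s Γ e T₁ ∧ WfAnn P m s a T₁ T₂ := by
  cases h with
  | cast h₁ h₂ _ => exact ⟨rfl, h₁, h₂⟩

theorem HasTy.app_inv {m : Mode} {s : Kind} {Γ : List (Ty Sg)} {U : Ty Sg}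
    {e₁ e₂ : Tm Sg} (h : HasTy P m s Γ (.app e₁ e₂) U) :
    ∃ T, HasTy P m s Γ e₁ (.arrow T U) ∧ HasTy P m s Γ e₂ T := by
  cases h with
  | app h₁ h₂ => exact ⟨_, h₁, h₂⟩

theorem HasTy.check_inv {m : Mode} {Γ : List (Ty Sg)} {B : Sg.Base} {e₁ e₂ : Tm Sg}
    {k : Sg.Const} {l : Option Sg.Label} {U : Ty Sg}
    (h : HasTy P m .runtime Γ (.check B e₁ e₂ k l) U) :
    U = .refine B e₁ ∧ Sg.ty k = B ∧ WfTy P m .runtime (.refine B e₁) ∧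
      HasTy P m .runtime [] e₂ (.triv Sg.bool) ∧ Steps P m (e₁.inst (.const k)) e₂ := by
  cases h with
  | check _ h₁ h₂ h₃ => exact ⟨rfl, rfl, h₁, h₂, h₃⟩

theorem HasTy.op_inv {m : Mode} {Γ : List (Ty Sg)} {o : Sg.Op} {es : Fin (Sg.arity o) → Tm Sg}
    {U : Ty Sg} (h : HasTy P m .runtime Γ (.op o es) U) :
    U = .refine (P.resBase o) (P.resPred o) ∧
      ∀ i, HasTy P m .runtime Γ (es i) (.refine (P.argBase o i) (P.argPred o i)) := by
  cases h with
  | op _ h => exact ⟨rfl, h⟩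

theorem hasTy_const {m : Mode} {k : Sg.Const} {B : Sg.Base} {p : Tm Sg}
    (hk : Sg.ty k = B) (hw : WfTy P m .runtime (.refine B p))
    (hs : Steps P m (p.inst (.const k)) (.const Sg.tt)) :
    HasTy P m .runtime [] (.const k) (.refine B p) := by
  subst hk
  exact .const .empty hw hs (by simp)

theorem hasTy_const_triv {m : Mode} {k : Sg.Const} {B : Sg.Base} (hk : Sg.ty k = B) :
    HasTy P m .runtime [] (.const k) (.triv B) :=
  hasTy_const hk (.base _) .refl

/-- The active check that a cast to a refinement starts is well typed. -/
theorem hasTy_check {m : Mode} {k : Sg.Const} {B : Sg.Base} {p : Tm Sg} {l : Option Sg.Label}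
    (hk : Sg.ty k = B) (hw : WfTy P m .runtime (.refine B p)) :
    HasTy P m .runtime [] (.check B p (p.inst (.const k)) k l) (.refine B p) := by
  subst hk
  exact .check .empty hw (hw.refine_inv.inst (hasTy_const_triv rfl)) .refl

/-- Subject reduction. The typing of active checks records that the condition is reachable from the
instantiated predicate, which is what types the constant that a successful check returns. -/
theorem HasTy.step (hops : OpsSound P .heedful) {e e' : Tm Sg} {T : Ty Sg}
    (h : HasTy P .heedful .runtime [] e T) (hs : Step P .heedful e e') :
    HasTy P .heedful .runtime [] e' T := by
  generalize hm : Mode.heedful = m at hs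
  induction hs generalizing T with
  | beta hv =>
    subst hm
    obtain ⟨U, h₁, h₂⟩ := h.app_inv
    obtain ⟨U', hU, h₁⟩ := h₁.lam_inv
    cases hU
    exact h₁.inst h₂
  | @op m o ks k hk =>
    subst hm
    obtain ⟨hT, h'⟩ := h.op_inv
    subst hT
    have := ((hops o).2.2 ks (fun i => (h' i).const_refine_inv.1)).2 k hk
    exact hasTy_const this.1 (hops o).2.1 this.2
  | unwrap hv hv' hd hc =>
    subst hm
    obtain ⟨U, h₁, h₂⟩ := h.app_inv
    obtain ⟨hU, h₁', ha⟩ := h₁.cast_inv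
    cases hU
    exact .cast (.app h₁' (.cast h₂ (ha.dom hd) (by simp))) (ha.cod hc) (by simp)
  | checkNone => cases hm
  | typeSet =>
    obtain ⟨rfl, h, ha⟩ := h.cast_inv
    obtain ⟨h₁, h₂, h₃, _⟩ := wfAnn_inv ha
    exact .cast h (wfAnn_ofFinset_iff.2 ⟨h₁, h₂, h₃, by simp⟩) (by simp)
  | checkEmpty =>
    obtain ⟨rfl, h, ha⟩ := h.cast_inv
    exact hasTy_check h.const_refine_inv.1 (wfAnn_inv ha).2.1
  | @checkSet B e₁ e₂ e₃ S l k hS hc =>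
    obtain ⟨rfl, h, ha⟩ := h.cast_inv
    obtain ⟨h₁, h₂, h₃, h₄⟩ := wfAnn_ofFinset_iff.1 ha
    have hmem := h₄ _ (hc ▸ P.choose_mem S hS)
    refine .cast (hasTy_check h.const_refine_inv.1 hmem.1) (wfAnn_ofFinset_iff.2
      ⟨hmem.1, h₂, .refine _ _ _, fun T hT => ?_⟩) (by simp)
    exact ⟨(h₄ T (Finset.mem_of_mem_erase hT)).1,
      (h₄ T (Finset.mem_of_mem_erase hT)).2.trans (.refine _ _ _)⟩
  | castMerge =>
    obtain ⟨rfl, h, ha⟩ := h.cast_inv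
    obtain ⟨_, h, ha'⟩ := h.cast_inv
    exact .cast h (ha'.merge ha) (by simp)
  | checkOK =>
    subst hm
    obtain ⟨rfl, rfl, hw, h, hs⟩ := h.check_inv
    exact hasTy_const rfl hw hs
  | checkFail =>
    subst hm
    obtain ⟨rfl, rfl, hw, h, hs⟩ := h.check_inv
    exact .blame .empty hw
  | appL _ ih =>
    subst hm
    obtain ⟨U, h₁, h₂⟩ := h.app_inv
    exact .app (ih h₁ rfl) h₂
  | appR _ _ ih =>
    subst hm
    obtain ⟨U, h₁, h₂⟩ := h.app_inv
    exact .app h₁ (ih h₂ rfl)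
  | @opInner m o es i e' _ _ ih =>
    subst hm
    obtain ⟨hT, h'⟩ := h.op_inv
    subst hT
    refine .op .empty (fun j => ?_)
    by_cases hj : j = i
    · subst hj; rw [Function.update_self]; exact ih (h' j) rfl
    · rw [Function.update_of_ne hj]; exact h' j
  | castInner _ _ _ ih =>
    subst hm
    obtain ⟨rfl, h, ha⟩ := h.cast_inv
    exact .cast (ih h rfl) ha (by simp)
  | checkInner hs ih =>
    subst hm
    obtain ⟨rfl, rfl, hw, h, hs'⟩ := h.check_inv
    exact .check .empty hw (ih h rfl) (hs'.tail hs)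
  | appRaiseL => subst hm; exact .blame .empty (h.wfTy hops)
  | appRaiseR => subst hm; exact .blame .empty (h.wfTy hops)
  | opRaise => subst hm; exact .blame .empty (h.wfTy hops)
  | castRaise => subst hm; exact .blame .empty (h.wfTy hops)
  | checkRaise => subst hm; exact .blame .empty (h.wfTy hops)

theorem HasTy.steps (hops : OpsSound P .heedful) {e e' : Tm Sg} {T : Ty Sg}
    (h : HasTy P .heedful .runtime [] e T) (hs : Steps P .heedful e e') :
    HasTy P .heedful .runtime [] e' T := by
  induction hs with
  | refl => exact h
  | tail _ hs ih => exact ih.step hops hs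

/-! ### Equality up to labels and evaluation up to labels -/

/-- Equality of terms up to the labels of casts, checks and blame. Labels inside types have to
agree: `choose` may depend on them. -/
inductive LabEq : Tm Sg → Tm Sg → Prop where
  | var (n : ℕ) : LabEq (.var n) (.var n)
  | const (k : Sg.Const) : LabEq (.const k) (.const k)
  | lam (T : Ty Sg) {e e' : Tm Sg} : LabEq e e' → LabEq (.lam T e) (.lam T e')
  | app {e₁ e₁' e₂ e₂' : Tm Sg} : LabEq e₁ e₁' → LabEq e₂ e₂' →
      LabEq (.app e₁ e₂) (.app e₁' e₂')
  | op {o : Sg.Op} {es es' : Fin (Sg.arity o) → Tm Sg} : (∀ i, LabEq (es i) (es' i)) →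
      LabEq (.op o es) (.op o es')
  | cast (T₁ T₂ : Ty Sg) (a : Ann Sg) (l l' : Option Sg.Label) {e e' : Tm Sg} : LabEq e e' →
      LabEq (.cast T₁ a T₂ l e) (.cast T₁ a T₂ l' e')
  | check (B : Sg.Base) (e₁ : Tm Sg) (k : Sg.Const) (l l' : Option Sg.Label) {e e' : Tm Sg} :
      LabEq e e' → LabEq (.check B e₁ e k l) (.check B e₁ e' k l')
  | blame (l l' : Option Sg.Label) : LabEq (.blame l) (.blame l')

theorem LabEq.refl : ∀ e : Tm Sg, LabEq e e
  | .var n => .var n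
  | .const k => .const k
  | .lam T e => .lam T (LabEq.refl e)
  | .app e₁ e₂ => .app (LabEq.refl e₁) (LabEq.refl e₂)
  | .op _ es => .op (fun i => LabEq.refl (es i))
  | .cast T₁ a T₂ l e => .cast T₁ T₂ a l l (LabEq.refl e)
  | .check B e₁ e₂ k l => .check B e₁ k l l (LabEq.refl e₂)
  | .blame l => .blame l l

theorem LabEq.trans {e₁ e₂ e₃ : Tm Sg} (h : LabEq e₁ e₂) (h' : LabEq e₂ e₃) : LabEq e₁ e₃ := by
  induction h generalizing e₃ with
  | var => exact h'
  | const => exact h'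
  | lam T _ ih => cases h' with | lam _ h' => exact .lam T (ih h')
  | app _ _ ih₁ ih₂ => cases h' with | app h₁ h₂ => exact .app (ih₁ h₁) (ih₂ h₂)
  | op _ ih => cases h' with | op h' => exact .op (fun i => ih i (h' i))
  | cast T₁ T₂ a l l' _ ih => cases h' with | cast _ _ _ _ _ h' => exact .cast _ _ _ _ _ (ih h')
  | check B e₁ k l l' _ ih =>
    cases h' with | check _ _ _ _ _ h' => exact .check _ _ _ _ _ (ih h')
  | blame l l' => cases h' with | blame => exact .blame _ _

theorem LabEq.rename {e e' : Tm Sg} (h : LabEq e e') (f : ℕ → ℕ) :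
    LabEq (e.rename f) (e'.rename f) := by
  induction h generalizing f with
  | var n => exact .refl _
  | const => exact .const _
  | lam T _ ih => exact .lam T (ih _)
  | app _ _ ih₁ ih₂ => exact .app (ih₁ f) (ih₂ f)
  | op _ ih => exact .op (fun i => ih i f)
  | cast T₁ T₂ a l l' _ ih => exact .cast _ _ _ _ _ (ih f)
  | check B e₁ k l l' _ ih => exact .check _ _ _ _ _ (ih f)
  | blame l l' => exact .blame _ _

theorem LabEq.subst {e e' : Tm Sg} (h : LabEq e e') {s s' : ℕ → Tm Sg}
    (hs : ∀ n, LabEq (s n) (s' n)) : LabEq (e.subst s) (e'.subst s') := by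
  induction h generalizing s s' with
  | var n => exact hs n
  | const => exact .const _
  | lam T _ ih =>
    refine .lam T (ih fun n => ?_)
    cases n with
    | zero => exact .var 0
    | succ n => exact (hs n).rename _
  | app _ _ ih₁ ih₂ => exact .app (ih₁ hs) (ih₂ hs)
  | op _ ih => exact .op (fun i => ih i hs)
  | cast T₁ T₂ a l l' _ ih => exact .cast _ _ _ _ _ (ih hs)
  | check B e₁ k l l' _ ih => exact .check _ _ _ _ _ (ih hs)
  | blame l l' => exact .blame _ _

theorem LabEq.inst {e e' v v' : Tm Sg} (h : LabEq e e') (hv : LabEq v v') :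
    LabEq (e.inst v) (e'.inst v') := by
  rw [Tm.inst_eq_subst, Tm.inst_eq_subst]
  refine h.subst fun n => ?_
  cases n with
  | zero => exact hv
  | succ n => exact .var n

theorem LabEq.val {m : Mode} {v v' : Tm Sg} (h : LabEq v v') (hv : Val m v') : Val m v := by
  induction hv generalizing v with
  | const => cases h; exact .const _
  | lam => cases h; exact .lam _ _
  | proxyC _ ih => cases h with | cast _ _ _ _ _ h => exact .proxyC (ih h)
  | proxyH => cases h with | cast _ _ _ _ _ h => cases h; exact .proxyH

theorem LabEq.mergeable {e e' : Tm Sg} (h : LabEq e e') (hm : Mergeable e) : Mergeable e' := by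
  obtain ⟨T₁, T₂, S, l, e₀, rfl⟩ := hm
  cases h with
  | cast => exact mergeable_cast_ofFinset _ _ _ _ _

/-- Labels do not influence reduction. -/
theorem LabEq.step {m : Mode} {e e' r' : Tm Sg} (h : LabEq e e') (hs : Step P m e' r') :
    ∃ r, Step P m e r ∧ LabEq r r' := by
  induction hs generalizing e with
  | beta hv =>
    cases h with
    | app h₁ h₂ =>
      cases h₁ with
      | lam _ h₁ => exact ⟨_, .beta (h₂.val hv), h₁.inst h₂⟩
  | @op m o ks k hk =>
    cases h with
    | @op _ es _ h =>
      have : es = fun i => .const (ks i) := by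
        funext i
        have := h i
        generalize es i = e at this
        cases this
        rfl
      subst this
      exact ⟨_, .op hk, .const _⟩
  | unwrap hv hv' hd hc =>
    cases h with
    | app h₁ h₂ =>
      have := h₁.val hv
      cases h₁ with
      | cast _ _ _ _ _ h₁ =>
        exact ⟨_, .unwrap this (h₂.val hv') hd hc,
          .cast _ _ _ _ _ (.app h₁ (.cast _ _ _ _ _ h₂))⟩
  | checkNone =>
    cases h with
    | cast _ _ _ _ _ h => cases h; exact ⟨_, .checkNone, .check _ _ _ _ _ (.refl _)⟩
  | typeSet =>
    cases h with
    | cast _ _ _ _ _ h => exact ⟨_, .typeSet, .cast _ _ _ _ _ h⟩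
  | checkEmpty =>
    cases h with
    | cast _ _ _ _ _ h => cases h; exact ⟨_, .checkEmpty, .check _ _ _ _ _ (.refl _)⟩
  | checkSet hS hc =>
    cases h with
    | cast _ _ _ _ _ h =>
      cases h
      exact ⟨_, .checkSet hS hc, .cast _ _ _ _ _ (.check _ _ _ _ _ (.refl _))⟩
  | castMerge =>
    cases h with
    | cast _ _ _ _ _ h =>
      cases h with
      | cast _ _ _ _ _ h => exact ⟨_, .castMerge, .cast _ _ _ _ _ h⟩
  | checkOK =>
    cases h with
    | check _ _ _ _ _ h => cases h; exact ⟨_, .checkOK, .const _⟩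
  | checkFail =>
    cases h with
    | check _ _ _ _ _ h => cases h; exact ⟨_, .checkFail, .blame _ _⟩
  | appL _ ih =>
    cases h with
    | app h₁ h₂ =>
      obtain ⟨r, hr, hl⟩ := ih h₁
      exact ⟨_, .appL hr, .app hl h₂⟩
  | appR hv _ ih =>
    cases h with
    | app h₁ h₂ =>
      obtain ⟨r, hr, hl⟩ := ih h₂
      exact ⟨_, .appR (h₁.val hv) hr, .app h₁ hl⟩
  | @opInner m o es' i e' hi _ ih =>
    cases h with
    | op h =>
      obtain ⟨r, hr, hl⟩ := ih (h i)
      refine ⟨_, .opInner (fun j hj => (h j).val (hi j hj)) hr, .op fun j => ?_⟩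
      by_cases hj : j = i
      · subst hj; simpa using hl
      · simpa [Function.update_of_ne hj] using h j
  | castInner ha hm _ ih =>
    cases h with
    | cast _ _ _ _ _ h =>
      obtain ⟨r, hr, hl⟩ := ih h
      exact ⟨_, .castInner ha (fun hh hm' => hm hh (h.mergeable hm')) hr, .cast _ _ _ _ _ hl⟩
  | checkInner _ ih =>
    cases h with
    | check _ _ _ _ _ h =>
      obtain ⟨r, hr, hl⟩ := ih h
      exact ⟨_, .checkInner hr, .check _ _ _ _ _ hl⟩
  | appRaiseL =>
    cases h with
    | app h₁ _ => cases h₁; exact ⟨_, .appRaiseL, .blame _ _⟩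
  | appRaiseR hv =>
    cases h with
    | app h₁ h₂ => cases h₂; exact ⟨_, .appRaiseR (h₁.val hv), .blame _ _⟩
  | @opRaise m o es i l hi he =>
    cases h with
    | @op _ es' _ h =>
      have := h i
      rw [he] at this
      generalize hes : es' i = e at this
      cases this with
      | blame l => exact ⟨_, .opRaise (fun j hj => (h j).val (hi j hj)) hes, .blame _ _⟩
  | castRaise ha =>
    cases h with
    | cast _ _ _ _ _ h => cases h; exact ⟨_, .castRaise ha, .blame _ _⟩
  | checkRaise =>
    cases h with
    | check _ _ _ _ _ h => cases h; exact ⟨_, .checkRaise, .blame _ _⟩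

theorem LabEq.steps {m : Mode} {e e' r' : Tm Sg} (h : LabEq e e') (hs : Steps P m e' r') :
    ∃ r, Steps P m e r ∧ LabEq r r' := by
  induction hs with
  | refl => exact ⟨e, .refl, h⟩
  | tail _ hs ih =>
    obtain ⟨r, hr, hl⟩ := ih
    obtain ⟨r', hr', hl'⟩ := hl.step hs
    exact ⟨r', hr.tail hr', hl'⟩

/-- `Sim P e e'`: in the heedful mode, whenever `e'` evaluates to a result then `e` evaluates to
the same result up to labels. -/
def Sim (P : Params Sg) (e e' : Tm Sg) : Prop :=
  ((∃ l, Steps P .heedful e' (.blame l)) → ∃ l, Steps P .heedful e (.blame l)) ∧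
  ∀ v', Val .heedful v' → Steps P .heedful e' v' →
    ∃ v, Val .heedful v ∧ Steps P .heedful e v ∧ LabEq v v'

theorem Sim.trans {e₁ e₂ e₃ : Tm Sg} (h : Sim P e₁ e₂) (h' : Sim P e₂ e₃) : Sim P e₁ e₃ := by
  refine ⟨fun hb => h.1 (h'.1 hb), fun v₃ hv₃ hs₃ => ?_⟩
  obtain ⟨v₂, hv₂, hs₂, hl₂⟩ := h'.2 v₃ hv₃ hs₃
  obtain ⟨v₁, hv₁, hs₁, hl₁⟩ := h.2 v₂ hv₂ hs₂
  exact ⟨v₁, hv₁, hs₁, hl₁.trans hl₂⟩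

theorem Sim.of_steps {e e' : Tm Sg} (h : Steps P .heedful e e') : Sim P e e' :=
  ⟨fun ⟨l, hl⟩ => ⟨l, h.trans hl⟩, fun v hv hs => ⟨v, hv, h.trans hs, .refl v⟩⟩

theorem Sim.refl (e : Tm Sg) : Sim P e e := .of_steps .refl

/-- Evaluation is deterministic, so a reduct has all results of the term it comes from. -/
theorem Sim.of_steps_rev {e e' : Tm Sg} (h : Steps P .heedful e' e) : Sim P e e' :=
  ⟨fun ⟨l, hl⟩ => ⟨l, h.factor hl (.blame l)⟩,
    fun v hv hs => ⟨v, hv, h.factor hs hv.result, .refl v⟩⟩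

theorem Sim.of_labEq {e e' : Tm Sg} (h : LabEq e e') : Sim P e e' := by
  constructor
  · rintro ⟨l, hl⟩
    obtain ⟨r, hr, hl⟩ := h.steps hl
    cases hl with
    | blame l => exact ⟨l, hr⟩
  · intro v hv hs
    obtain ⟨r, hr, hl⟩ := h.steps hs
    exact ⟨r, hl.val hv, hr, hl⟩

theorem Sim.of_common {e e' r : Tm Sg} (h : Steps P .heedful e r) (h' : Steps P .heedful e' r) :
    Sim P e e' :=
  (Sim.of_steps h).trans (.of_steps_rev h')

theorem Sim.of_blame {e e' : Tm Sg} (h : ∃ l, Steps P .heedful e (.blame l))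
    (h' : ∃ l, Steps P .heedful e' (.blame l)) : Sim P e e' := by
  refine ⟨fun _ => h, fun v hv hs => ?_⟩
  obtain ⟨l, hl⟩ := h'
  exact (not_val_blame (hs.result_unique hv.result hl (.blame l) ▸ hv)).elim

/-! ### Hereditarily halting types -/

/-- The condition `e` of a check evaluates heedfully to `true`, `false` or blame. -/
def Halts (P : Params Sg) (e : Tm Sg) : Prop :=
  Steps P .heedful e (.const Sg.tt) ∨ Steps P .heedful e (.const Sg.ff) ∨
    ∃ l, Steps P .heedful e (.blame l)

mutual
/-- A type is hereditarily halting if all its refinements halt on constants of their base type,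
and the same holds for all types in casts in the refinement predicates. -/
inductive GoodTy (P : Params Sg) : Ty Sg → Prop where
  | refine {B : Sg.Base} {e : Tm Sg} : GoodTm P e →
      (∀ k, Sg.ty k = B → Halts P (e.inst (.const k))) → GoodTy P (.refine B e)
  | arrow {T₁ T₂ : Ty Sg} : GoodTy P T₁ → GoodTy P T₂ → GoodTy P (.arrow T₁ T₂)
/-- All casts in the term are between, and annotated with, hereditarily halting types. -/
inductive GoodTm (P : Params Sg) : Tm Sg → Prop where
  | var (n : ℕ) : GoodTm P (.var n)
  | const (k : Sg.Const) : GoodTm P (.const k)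
  | lam {T : Ty Sg} {e : Tm Sg} : GoodTm P e → GoodTm P (.lam T e)
  | app {e₁ e₂ : Tm Sg} : GoodTm P e₁ → GoodTm P e₂ → GoodTm P (.app e₁ e₂)
  | op {o : Sg.Op} {es : Fin (Sg.arity o) → Tm Sg} : (∀ i, GoodTm P (es i)) →
      GoodTm P (.op o es)
  | cast {T₁ T₂ : Ty Sg} {a : Ann Sg} {l : Option Sg.Label} {e : Tm Sg} : GoodTy P T₁ →
      GoodTy P T₂ → (∀ S, a = .ofFinset S → ∀ T ∈ S, GoodTy P T) → GoodTm P e →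
      GoodTm P (.cast T₁ a T₂ l e)
  | check {B : Sg.Base} {e₁ e₂ : Tm Sg} {k : Sg.Const} {l : Option Sg.Label} : GoodTm P e₂ →
      GoodTm P (.check B e₁ e₂ k l)
  | blame (l : Option Sg.Label) : GoodTm P (.blame l)
end

theorem GoodTm.cast_inv {T₁ T₂ : Ty Sg} {a : Ann Sg} {l : Option Sg.Label} {e : Tm Sg}
    (h : GoodTm P (.cast T₁ a T₂ l e)) : GoodTy P T₁ ∧ GoodTy P T₂ ∧
      (∀ S, a = .ofFinset S → ∀ T ∈ S, GoodTy P T) ∧ GoodTm P e := by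
  cases h with | cast h₁ h₂ h₃ h₄ => exact ⟨h₁, h₂, h₃, h₄⟩

theorem GoodTm.app_inv {e₁ e₂ : Tm Sg} (h : GoodTm P (.app e₁ e₂)) :
    GoodTm P e₁ ∧ GoodTm P e₂ := by
  cases h with | app h₁ h₂ => exact ⟨h₁, h₂⟩

theorem GoodTm.op_inv {o : Sg.Op} {es : Fin (Sg.arity o) → Tm Sg} (h : GoodTm P (.op o es))
    (i : Fin (Sg.arity o)) : GoodTm P (es i) := by
  cases h with | op h => exact h i

theorem GoodTm.lam_inv {T : Ty Sg} {e : Tm Sg} (h : GoodTm P (.lam T e)) : GoodTm P e := by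
  cases h with | lam h => exact h

theorem GoodTm.check_inv {B : Sg.Base} {e₁ e₂ : Tm Sg} {k : Sg.Const} {l : Option Sg.Label}
    (h : GoodTm P (.check B e₁ e₂ k l)) : GoodTm P e₂ := by
  cases h with | check h => exact h

theorem GoodTy.refine_inv {B : Sg.Base} {e : Tm Sg} (h : GoodTy P (.refine B e)) :
    GoodTm P e ∧ ∀ k, Sg.ty k = B → Halts P (e.inst (.const k)) := by
  cases h with | refine h₁ h₂ => exact ⟨h₁, h₂⟩

theorem GoodTy.dom {T : Ty Sg} (h : GoodTy P T) : GoodTy P T.dom := by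
  cases h with
  | refine h₁ h₂ => exact .refine h₁ h₂
  | arrow h _ => exact h

theorem GoodTy.cod {T : Ty Sg} (h : GoodTy P T) : GoodTy P T.cod := by
  cases h with
  | refine h₁ h₂ => exact .refine h₁ h₂
  | arrow _ h => exact h

theorem GoodTm.rename : ∀ {e : Tm Sg}, GoodTm P e → ∀ f, GoodTm P (e.rename f)
  | .var _, _, _ => .var _
  | .const _, _, _ => .const _
  | .lam _ _, h, _ => .lam (h.lam_inv.rename _)
  | .app _ _, h, f => .app (h.app_inv.1.rename f) (h.app_inv.2.rename f)
  | .op _ _, h, f => .op (fun i => (h.op_inv i).rename f)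
  | .cast _ _ _ _ _, h, f =>
    .cast h.cast_inv.1 h.cast_inv.2.1 h.cast_inv.2.2.1 (h.cast_inv.2.2.2.rename f)
  | .check _ _ _ _ _, h, f => .check (h.check_inv.rename f)
  | .blame _, _, _ => .blame _

theorem GoodTm.liftSubst {s : ℕ → Tm Sg} (hs : ∀ n, GoodTm P (s n)) (n : ℕ) :
    GoodTm P (Tm.liftSubst s n) := by
  cases n with
  | zero => exact .var 0
  | succ n => exact (hs n).rename _

theorem GoodTm.subst : ∀ {e : Tm Sg}, GoodTm P e → ∀ {s : ℕ → Tm Sg}, (∀ n, GoodTm P (s n)) →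
    GoodTm P (e.subst s)
  | .var n, _, _, hs => hs n
  | .const _, _, _, _ => .const _
  | .lam _ _, h, _, hs => .lam (h.lam_inv.subst (GoodTm.liftSubst hs))
  | .app _ _, h, _, hs => .app (h.app_inv.1.subst hs) (h.app_inv.2.subst hs)
  | .op _ _, h, _, hs => .op (fun i => (h.op_inv i).subst hs)
  | .cast _ _ _ _ _, h, _, hs =>
    .cast h.cast_inv.1 h.cast_inv.2.1 h.cast_inv.2.2.1 (h.cast_inv.2.2.2.subst hs)
  | .check _ _ _ _ _, h, _, hs => .check (h.check_inv.subst hs)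
  | .blame _, _, _, _ => .blame _

theorem GoodTm.scons {v : Tm Sg} {s : ℕ → Tm Sg} (hv : GoodTm P v) (hs : ∀ n, GoodTm P (s n))
    (n : ℕ) : GoodTm P (Tm.scons v s n) := by
  cases n with
  | zero => exact hv
  | succ n => exact hs n

theorem GoodTm.inst {e v : Tm Sg} (h : GoodTm P e) (hv : GoodTm P v) : GoodTm P (e.inst v) := by
  rw [Tm.inst_eq_subst]
  exact h.subst (hv.scons .var)

theorem GoodTm.step {m : Mode} {e e' : Tm Sg} (h : GoodTm P e) (hs : Step P m e e') :
    GoodTm P e' := by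
  induction hs with
  | beta => exact h.app_inv.1.lam_inv.inst h.app_inv.2
  | op => exact .const _
  | unwrap _ _ hd hc =>
    obtain ⟨h, h'⟩ := h.app_inv
    obtain ⟨h₁, h₂, h₃, h₄⟩ := h.cast_inv
    refine .cast h₁.cod h₂.cod ?_ (.app h₄ (.cast h₂.dom h₁.dom ?_ h'))
    · cases hc with
      | none => simp
      | set S =>
        intro S' hS T hT
        obtain rfl := Ann.ofFinset_inj.1 hS
        obtain ⟨U, hU, rfl⟩ := Finset.mem_image.1 hT
        exact (h₃ S rfl U hU).cod
    · cases hd with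
      | none => simp
      | set S =>
        intro S' hS T hT
        obtain rfl := Ann.ofFinset_inj.1 hS
        obtain ⟨U, hU, rfl⟩ := Finset.mem_image.1 hT
        exact (h₃ S rfl U hU).dom
  | checkNone => exact .check (h.cast_inv.2.1.refine_inv.1.inst (.const _))
  | typeSet =>
    obtain ⟨h₁, h₂, h₃, h₄⟩ := h.cast_inv
    refine .cast h₁ h₂ (fun S hS T hT => ?_) h₄
    obtain rfl := Ann.ofFinset_inj.1 hS
    simp at hT
  | checkEmpty => exact .check (h.cast_inv.2.1.refine_inv.1.inst (.const _))
  | @checkSet B e₁ e₂ e₃ S l k hS hc =>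
    obtain ⟨h₁, h₂, h₃, h₄⟩ := h.cast_inv
    have hmem := h₃ S rfl _ (hc ▸ P.choose_mem S hS)
    refine .cast hmem h₂ (fun S' hS' T hT => ?_) (.check (hmem.refine_inv.1.inst (.const _)))
    obtain rfl := Ann.ofFinset_inj.1 hS'
    exact h₃ S rfl T (Finset.mem_of_mem_erase hT)
  | castMerge =>
    obtain ⟨h₁, h₂, h₃, h₄⟩ := h.cast_inv
    obtain ⟨h₁', h₂', h₃', h₄'⟩ := h₄.cast_inv
    refine .cast h₁' h₂ (fun S hS T hT => ?_) h₄'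
    obtain rfl := Ann.ofFinset_inj.1 hS
    rw [Finset.mem_union, Finset.mem_union, Finset.mem_singleton] at hT
    rcases hT with (hT | hT) | rfl
    · exact h₃' _ rfl T hT
    · exact h₃ _ rfl T hT
    · exact h₁
  | checkOK => exact .const _
  | checkFail => exact .blame _
  | appL _ ih => exact .app (ih h.app_inv.1) h.app_inv.2
  | appR _ _ ih => exact .app h.app_inv.1 (ih h.app_inv.2)
  | @opInner m o es i e' _ _ ih =>
    refine .op fun j => ?_
    by_cases hj : j = i
    · subst hj; rw [Function.update_self]; exact ih (h.op_inv j)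
    · rw [Function.update_of_ne hj]; exact h.op_inv j
  | castInner _ _ _ ih =>
    obtain ⟨h₁, h₂, h₃, h₄⟩ := h.cast_inv
    exact .cast h₁ h₂ h₃ (ih h₄)
  | checkInner _ ih => exact .check (ih h.check_inv)
  | appRaiseL => exact .blame _
  | appRaiseR => exact .blame _
  | opRaise => exact .blame _
  | castRaise => exact .blame _
  | checkRaise => exact .blame _

/-- Closed, heedfully well typed, with hereditarily halting casts. -/
def Ok (P : Params Sg) (e : Tm Sg) (T : Ty Sg) : Prop :=
  HasTy P .heedful .runtime [] e T ∧ GoodTm P e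

/-- A heedfully well-formed and hereditarily halting type. -/
def OkTy (P : Params Sg) (T : Ty Sg) : Prop := WfTy P .heedful .runtime T ∧ GoodTy P T

/-- The types of a cast `⟨T₁ ⇒ˢ T₂⟩` are compatible, well formed and hereditarily halting. -/
def OkCast (P : Params Sg) (T₁ : Ty Sg) (S : Finset (Ty Sg)) (T₂ : Ty Sg) : Prop :=
  OkTy P T₁ ∧ OkTy P T₂ ∧ Compat T₁ T₂ ∧ ∀ U ∈ S, OkTy P U ∧ Compat U T₁

theorem OkTy.dom {T : Ty Sg} (h : OkTy P T) : OkTy P T.dom := ⟨h.1.dom, h.2.dom⟩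

theorem OkTy.cod {T : Ty Sg} (h : OkTy P T) : OkTy P T.cod := ⟨h.1.cod, h.2.cod⟩

theorem OkCast.empty {T₁ T₂ : Ty Sg} (h₁ : OkTy P T₁) (h₂ : OkTy P T₂) (h : Compat T₁ T₂) :
    OkCast P T₁ ∅ T₂ :=
  ⟨h₁, h₂, h, by simp⟩

theorem OkCast.dom {T₁₁ T₁₂ T₂₁ T₂₂ : Ty Sg} {S : Finset (Ty Sg)}
    (h : OkCast P (.arrow T₁₁ T₁₂) S (.arrow T₂₁ T₂₂)) :
    OkCast P T₂₁ (S.image Ty.dom) T₁₁ := by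
  obtain ⟨h₁, h₂, h₃, h₄⟩ := h
  refine ⟨h₂.dom, h₁.dom, h₃.symm.dom, fun T hT => ?_⟩
  obtain ⟨U, hU, rfl⟩ := Finset.mem_image.1 hT
  exact ⟨(h₄ U hU).1.dom, ((h₄ U hU).2.trans h₃).dom⟩

theorem OkCast.cod {T₁₁ T₁₂ T₂₁ T₂₂ : Ty Sg} {S : Finset (Ty Sg)}
    (h : OkCast P (.arrow T₁₁ T₁₂) S (.arrow T₂₁ T₂₂)) :
    OkCast P T₁₂ (S.image Ty.cod) T₂₂ := by
  obtain ⟨h₁, h₂, h₃, h₄⟩ := h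
  refine ⟨h₁.cod, h₂.cod, h₃.cod, fun T hT => ?_⟩
  obtain ⟨U, hU, rfl⟩ := Finset.mem_image.1 hT
  exact ⟨(h₄ U hU).1.cod, (h₄ U hU).2.cod⟩

theorem OkCast.merge {S₁ S₂ : Finset (Ty Sg)} {T₁ T₂ T₃ : Ty Sg} (h : OkCast P T₁ S₁ T₂)
    (h' : OkCast P T₂ S₂ T₃) : OkCast P T₁ (S₁ ∪ S₂ ∪ {T₂}) T₃ := by
  obtain ⟨h₁, h₂, h₃, h₄⟩ := h
  obtain ⟨h₁', h₂', h₃', h₄'⟩ := h'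
  refine ⟨h₁, h₂', h₃.trans h₃', fun T hT => ?_⟩
  rw [Finset.mem_union, Finset.mem_union, Finset.mem_singleton] at hT
  rcases hT with (hT | hT) | rfl
  · exact h₄ T hT
  · exact ⟨(h₄' T hT).1, (h₄' T hT).2.trans h₃.symm⟩
  · exact ⟨h₂, h₃.symm⟩

theorem Ok.steps (hops : OpsSound P .heedful) {e e' : Tm Sg} {T : Ty Sg} (h : Ok P e T)
    (hs : Steps P .heedful e e') : Ok P e' T := by
  refine ⟨h.1.steps hops hs, ?_⟩
  induction hs with
  | refl => exact h.2
  | tail _ hs ih => exact ih.step hs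

theorem Ok.app {e₁ e₂ : Tm Sg} {T₁ T₂ : Ty Sg} (h₁ : Ok P e₁ (.arrow T₁ T₂)) (h₂ : Ok P e₂ T₁) :
    Ok P (.app e₁ e₂) T₂ :=
  ⟨.app h₁.1 h₂.1, .app h₁.2 h₂.2⟩

theorem Ok.cast {T₁ T₂ : Ty Sg} {S : Finset (Ty Sg)} {e : Tm Sg} (h : Ok P e T₁)
    (hc : OkCast P T₁ S T₂) (l : Option Sg.Label) : Ok P (.cast T₁ (.ofFinset S) T₂ l e) T₂ := by
  obtain ⟨h₁, h₂, h₃, h₄⟩ := hc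
  refine ⟨.cast h.1 (wfAnn_ofFinset_iff.2 ⟨h₁.1, h₂.1, h₃, fun T hT => ⟨(h₄ T hT).1.1,
    (h₄ T hT).2⟩⟩) (by simp), .cast h₁.2 h₂.2 (fun S' hS T hT => ?_) h.2⟩
  obtain rfl := Ann.ofFinset_inj.1 hS
  exact (h₄ T hT).1.2

theorem Ok.cast_inv {T₁ T₂ T : Ty Sg} {S : Finset (Ty Sg)} {e : Tm Sg} {l : Option Sg.Label}
    (h : Ok P (.cast T₁ (.ofFinset S) T₂ l e) T) : T = T₂ ∧ Ok P e T₁ ∧ OkCast P T₁ S T₂ := by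
  obtain ⟨rfl, he, ha⟩ := h.1.cast_inv
  obtain ⟨h₁, h₂, h₃, h₄⟩ := wfAnn_ofFinset_iff.1 ha
  obtain ⟨g₁, g₂, g₃, g₄⟩ := h.2.cast_inv
  exact ⟨rfl, ⟨he, g₄⟩, ⟨h₁, g₁⟩, ⟨h₂, g₂⟩, h₃, fun U hU =>
    ⟨⟨(h₄ U hU).1, g₃ S rfl U hU⟩, (h₄ U hU).2⟩⟩

/-! ### Heedful casts of constants -/

/-- The constant `k` satisfies all refinements in `S`. -/
def Passes (P : Params Sg) (S : Finset (Ty Sg)) (k : Sg.Const) : Prop :=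
  ∀ B e, Ty.refine B e ∈ S → Steps P .heedful (e.inst (.const k)) (.const Sg.tt)

/-- `e` evaluates to `k` if `k` satisfies all refinements in `S`, and to blame otherwise. In
particular the outcome does not depend on the order in which these refinements are checked. -/
def ChecksAll (P : Params Sg) (S : Finset (Ty Sg)) (k : Sg.Const) (e : Tm Sg) : Prop :=
  (Passes P S k ∧ Steps P .heedful e (.const k)) ∨
    (¬ Passes P S k ∧ ∃ l, Steps P .heedful e (.blame l))

theorem ChecksAll.sim {S : Finset (Ty Sg)} {k : Sg.Const} {e e' : Tm Sg}
    (h : ChecksAll P S k e) (h' : ChecksAll P S k e') : Sim P e e' := by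
  rcases h with ⟨hp, h⟩ | ⟨hp, h⟩ <;> rcases h' with ⟨hp', h'⟩ | ⟨hp', h'⟩
  · exact .of_common h h'
  · exact (hp' hp).elim
  · exact (hp hp').elim
  · exact .of_blame h h'

theorem ChecksAll.head {S : Finset (Ty Sg)} {k : Sg.Const} {e e' : Tm Sg}
    (hs : Steps P .heedful e e') (h : ChecksAll P S k e') : ChecksAll P S k e := by
  rcases h with ⟨hp, h⟩ | ⟨hp, l, h⟩
  · exact .inl ⟨hp, hs.trans h⟩
  · exact .inr ⟨hp, l, hs.trans h⟩

theorem tt_ne_ff_steps {e : Tm Sg} {m : Mode} (h : Steps P m e (.const Sg.tt)) :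
    ¬ Steps P m e (.const Sg.ff) := fun h' =>
  Sg.tt_ne_ff (Tm.const.inj (h.result_unique (Val.const _).result h' (Val.const _).result))

theorem tt_ne_blame_steps {e : Tm Sg} {m : Mode} (h : Steps P m e (.const Sg.tt))
    (l : Option Sg.Label) : ¬ Steps P m e (.blame l) := fun h' => by
  have := h.result_unique (Val.const _).result h' (.blame l)
  cases this

/-- An active check of one refinement. -/
theorem checksAll_check {B : Sg.Base} {p : Tm Sg} {k : Sg.Const} (h : OkTy P (.refine B p))
    (hk : Sg.ty k = B) (l : Option Sg.Label) :
    ChecksAll P {.refine B p} k (.check B p (p.inst (.const k)) k l) := by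
  have hp : Passes P {.refine B p} k ↔ Steps P .heedful (p.inst (.const k)) (.const Sg.tt) := by
    simp [Passes]
  rcases h.2.refine_inv.2 k hk with h | h | ⟨l', h⟩
  · exact .inl ⟨hp.2 h, .check_ok h⟩
  · exact .inr ⟨fun hh => tt_ne_ff_steps (hp.1 hh) h, l, .check_ff h⟩
  · exact .inr ⟨fun hh => tt_ne_blame_steps (hp.1 hh) l' h, l', .check_blame h⟩

/-- A run that stays within non-mergeable terms until it reaches a result can be carried out under
a heedful cast. -/
theorem Steps.heedful_cast_of_invariant {T₁ T₂ : Ty Sg} {S : Finset (Ty Sg)}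
    {l : Option Sg.Label} (Q : Tm Sg → Prop) (hQ : ∀ e, Q e → ¬ Mergeable e)
    (hQs : ∀ e e', Q e → Step P .heedful e e' → Q e' ∨ Result .heedful e') {e r : Tm Sg}
    (he : Q e) (h : Steps P .heedful e r) :
    Steps P .heedful (.cast T₁ (.ofFinset S) T₂ l e) (.cast T₁ (.ofFinset S) T₂ l r) := by
  induction h using Relation.ReflTransGen.head_induction_on with
  | refl => exact .refl
  | head hs hr ih =>
    refine .head (.castInner (.heedful S) (fun _ => hQ _ he) hs) ?_
    rcases hQs _ _ he hs with h | h
    · exact ih h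
    · rw [h.eq_of_steps hr]

/-- Active checks are evaluated under casts. -/
theorem Steps.heedful_cast_check {T₁ T₂ : Ty Sg} {S : Finset (Ty Sg)} {l l' : Option Sg.Label}
    {B : Sg.Base} {p e r : Tm Sg} {k : Sg.Const} (h : Steps P .heedful (.check B p e k l') r) :
    Steps P .heedful (.cast T₁ (.ofFinset S) T₂ l (.check B p e k l'))
      (.cast T₁ (.ofFinset S) T₂ l r) := by
  refine Steps.heedful_cast_of_invariant (fun e => ∃ e₀, e = .check B p e₀ k l') ?_ ?_ ⟨e, rfl⟩ h
  · rintro _ ⟨e₀, rfl⟩; simp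
  · rintro _ e' ⟨e₀, rfl⟩ hs
    rcases hs.check_inv with ⟨_, rfl⟩ | ⟨_, rfl⟩ | ⟨e'', _, rfl⟩ | ⟨_, _, rfl⟩
    · exact .inr (Val.const _).result
    · exact .inr (.blame _)
    · exact .inl ⟨_, rfl⟩
    · exact .inr (.blame _)

theorem passes_union {S S' : Finset (Ty Sg)} {k : Sg.Const} :
    Passes P (S ∪ S') k ↔ Passes P S k ∧ Passes P S' k := by
  simp only [Passes, Finset.mem_union]
  constructor
  · exact fun h => ⟨fun B e he => h B e (.inl he), fun B e he => h B e (.inr he)⟩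
  · rintro ⟨h₁, h₂⟩ B e (he | he)
    · exact h₁ B e he
    · exact h₂ B e he

/-- If a cast of `k` checks `S'`, then the same cast of an active check for `p` also checks
`p`. -/
theorem ChecksAll.cast_check {B : Sg.Base} {p : Tm Sg} {k : Sg.Const} {T₁ T₂ : Ty Sg}
    {S S' : Finset (Ty Sg)} {l : Option Sg.Label} (hp : OkTy P (.refine B p)) (hk : Sg.ty k = B)
    (h : ChecksAll P S' k (.cast T₁ (.ofFinset S) T₂ l (.const k))) (l' : Option Sg.Label) :
    ChecksAll P ({.refine B p} ∪ S') k
      (.cast T₁ (.ofFinset S) T₂ l (.check B p (p.inst (.const k)) k l')) := by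
  unfold ChecksAll
  rw [passes_union]
  rcases checksAll_check hp hk l' with ⟨h₁, h₂⟩ | ⟨h₁, l'', h₂⟩
  · rcases h with ⟨h₃, h₄⟩ | ⟨h₃, l'', h₄⟩
    · exact .inl ⟨⟨h₁, h₃⟩, h₂.heedful_cast_check.trans h₄⟩
    · exact .inr ⟨fun h => h₃ h.2, l'', h₂.heedful_cast_check.trans h₄⟩
  · exact .inr ⟨fun h => h₁ h.1, l'', h₂.heedful_cast_check.tail (.castRaise (.heedful S))⟩

theorem Compat.refine_inv {B : Sg.Base} {e : Tm Sg} {T : Ty Sg} (h : Compat (.refine B e) T) :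
    ∃ e', T = .refine B e' := by
  cases h with | refine => exact ⟨_, rfl⟩

/-- A heedful cast of a constant checks all types of its annotation and its target. -/
theorem checksAll_cast_const {B : Sg.Base} {p q : Tm Sg} {k : Sg.Const} {S : Finset (Ty Sg)}
    {l : Option Sg.Label} (hk : Sg.ty k = B) (h : OkCast P (.refine B p) S (.refine B q)) :
    ChecksAll P (S ∪ {.refine B q}) k
      (.cast (.refine B p) (.ofFinset S) (.refine B q) l (.const k)) := by
  induction S using Finset.strongInduction generalizing p with
  | H S ih =>
    rcases S.eq_empty_or_nonempty with rfl | hS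
    · rw [Finset.empty_union]
      exact (checksAll_check h.2.1 hk l).head (.single .checkEmpty)
    · obtain ⟨h₁, h₂, h₃, h₄⟩ := h
      have hmem := P.choose_mem S hS
      obtain ⟨hU, hc⟩ := h₄ _ hmem
      obtain ⟨p', hp'⟩ := hc.symm.refine_inv
      rw [hp'] at hmem hU hc
      have hcast : OkCast P (.refine B p') (S.erase (.refine B p')) (.refine B q) :=
        ⟨hU, h₂, .refine _ _ _, fun V hV =>
          ⟨(h₄ V (Finset.mem_of_mem_erase hV)).1,
            (h₄ V (Finset.mem_of_mem_erase hV)).2.trans (.refine _ _ _)⟩⟩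
      have := (ih _ (Finset.erase_ssubset hmem) hcast).cast_check hU hk l
      rw [← Finset.union_assoc, ← Finset.insert_eq, Finset.insert_erase hmem] at this
      exact this.head (.single (.checkSet hS hp'))

/-! ### Evaluation inside a heedful cast -/

/-- One step inside a heedful cast. If the argument is itself an annotated cast, the two casts
merge before the argument can take this step. In the end this makes no difference, up to labels:
checking several refinements of a constant gives a result that is independent of the order,
because all these checks halt. -/
theorem Sim.cast_step {e e' : Tm Sg} {T₁ T₂ : Ty Sg} {S : Finset (Ty Sg)} {l : Option Sg.Label}
    (he : Ok P e T₁) (hc : OkCast P T₁ S T₂) (hs : Step P .heedful e e') :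
    Sim P (.cast T₁ (.ofFinset S) T₂ l e) (.cast T₁ (.ofFinset S) T₂ l e') := by
  by_cases hm : Mergeable e
  swap
  · exact .of_steps (.single (.castInner (.heedful S) (fun _ => hm) hs))
  obtain ⟨T₀, T, S₀, l₀, e₀, rfl⟩ := hm
  obtain ⟨rfl, he₀, hc₀⟩ := he.cast_inv
  have hmerge : ∀ e₁, Step P .heedful (.cast T₁ (.ofFinset S) T₂ l
      (.cast T₀ (.ofFinset S₀) T₁ l₀ e₁)) (.cast T₀ (.ofFinset (S₀ ∪ S ∪ {T₁})) T₂ l e₁) :=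
    fun e₁ => .castMerge
  rcases hs.cast_inv with ⟨h, _⟩ | ⟨_, h, _⟩ | ⟨_, h, B, p, q, k, rfl, rfl, rfl, rfl⟩ |
    ⟨_, S', B, p, p', q, k, h, hS, hch, rfl, rfl, rfl, rfl⟩ |
    ⟨_, S', Tx, Sx, lx, ex, h, rfl, rfl⟩ |
    ⟨_, hm, e₀', hs₀, rfl⟩ | ⟨_, l', rfl, rfl⟩
  · cases h
  · simp at h
  -- the inner cast checks its target while the outer cast, if merged, checks everything
  · obtain rfl := Ann.ofFinset_inj.1 h
    obtain ⟨r, rfl⟩ := hc.2.2.1.refine_inv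
    have hk := he₀.1.const_refine_inv.1
    refine ChecksAll.sim (k := k) ((checksAll_cast_const hk (hc₀.merge hc)).head
      (.single (hmerge _))) ?_
    have := (checksAll_cast_const (l := l) hk hc).cast_check hc.1 hk l₀
    convert this using 1
    ext U; simp only [Finset.mem_union, Finset.mem_singleton, Finset.notMem_empty]; tauto
  -- the inner cast picks `choose S₀`, while the merged cast may pick any other type
  · obtain rfl := Ann.ofFinset_inj.1 h
    obtain ⟨r, rfl⟩ := hc.2.2.1.refine_inv
    have hk := he₀.1.const_refine_inv.1
    refine ChecksAll.sim (k := k) ((checksAll_cast_const hk (hc₀.merge hc)).head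
      (.single (hmerge _))) ?_
    have hmem := P.choose_mem S₀ hS
    rw [hch] at hmem
    have hp' := (hc₀.2.2.2 _ hmem).1
    have hc' : OkCast P (.refine B p') (S₀.erase (.refine B p')) (.refine B q) :=
      ⟨hp', hc₀.2.1, .refine _ _ _, fun V hV =>
        ⟨(hc₀.2.2.2 V (Finset.mem_of_mem_erase hV)).1,
          (hc₀.2.2.2 V (Finset.mem_of_mem_erase hV)).2.trans (.refine _ _ _)⟩⟩
    have := (checksAll_cast_const (l := l) hk (hc'.merge hc)).cast_check hp' hk l₀
    refine ChecksAll.head (.single .castMerge) ?_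
    convert this using 1
    ext U
    by_cases hU : U = .refine B p'
    · subst hU; simp [hmem]
    · simp [hU]
  -- three casts in a row: both orders of merging give the same type set
  · obtain rfl := Ann.ofFinset_inj.1 h
    refine .of_common (.head (hmerge _) (.single .castMerge)) (.single ?_)
    convert Step.castMerge using 3
    ext U; simp only [Finset.mem_union, Finset.mem_singleton]; tauto
  · exact .of_common (.head (hmerge _) (.single (.castInner (.heedful _) hm hs₀)))
      (.single .castMerge)
  · exact .of_blame ⟨l', .head (hmerge _) (.single (.castRaise (.heedful _)))⟩
      ⟨l', .single (.castRaise (.heedful _))⟩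

/-- Evaluation of the argument of a heedful cast. -/
theorem Sim.cast_steps (hops : OpsSound P .heedful) {e e' : Tm Sg} {T₁ T₂ : Ty Sg}
    {S : Finset (Ty Sg)} {l : Option Sg.Label} (he : Ok P e T₁) (hc : OkCast P T₁ S T₂)
    (hs : Steps P .heedful e e') :
    Sim P (.cast T₁ (.ofFinset S) T₂ l e) (.cast T₁ (.ofFinset S) T₂ l e') := by
  induction hs using Relation.ReflTransGen.head_induction_on with
  | refl => exact .refl _
  | head hs _ ih => exact (Sim.cast_step he hc hs).trans (ih (he.steps hops (.single hs)))

/-! ### Unwrapping merged proxies -/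

theorem Steps.cast_appR {T₁ T₂ : Ty Sg} {S : Finset (Ty Sg)} {l : Option Sg.Label}
    {v e e' : Tm Sg} (hv : Val .heedful v) (h : Steps P .heedful e e') :
    Steps P .heedful (.cast T₁ (.ofFinset S) T₂ l (.app v e))
      (.cast T₁ (.ofFinset S) T₂ l (.app v e')) :=
  Relation.ReflTransGen.lift (fun e => Tm.cast T₁ (.ofFinset S) T₂ l (.app v e))
    (fun _ _ h => Step.castInner (.heedful S) (by simp) (Step.appR hv h)) _ _ h

theorem Steps.cast_appR_blame {T₁ T₂ : Ty Sg} {S : Finset (Ty Sg)} {l l' : Option Sg.Label}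
    {v e : Tm Sg} (hv : Val .heedful v) (h : Steps P .heedful e (.blame l')) :
    Steps P .heedful (.cast T₁ (.ofFinset S) T₂ l (.app v e)) (.blame l') :=
  ((h.cast_appR hv).tail (.castInner (.heedful S) (by simp) (.appRaiseR hv))).tail
    (.castRaise (.heedful S))

theorem not_val_cast_app {m : Mode} {T₁ T₂ : Ty Sg} {a : Ann Sg} {l : Option Sg.Label}
    {e₁ e₂ : Tm Sg} : ¬ Val m (.cast T₁ a T₂ l (.app e₁ e₂)) := by
  intro h
  cases h with
  | proxyC h => cases h

/-- If a cast of an application of an abstraction has a result, then so has the argument. -/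
theorem result_of_cast_app_lam {T₁ T₂ T : Ty Sg} {S : Finset (Ty Sg)} {l : Option Sg.Label}
    {b e r : Tm Sg} (h : Steps P .heedful (.cast T₁ (.ofFinset S) T₂ l (.app (.lam T b) e)) r)
    (hr : Result .heedful r) : ∃ r', Result .heedful r' ∧ Steps P .heedful e r' := by
  generalize hx : Tm.cast T₁ (.ofFinset S) T₂ l (.app (.lam T b) e) = x at h
  induction h using Relation.ReflTransGen.head_induction_on generalizing e with
  | refl =>
    subst hx
    rcases hr with hr | ⟨l, hr⟩
    · exact (not_val_cast_app hr).elim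
    · cases hr
  | head hs _ ih =>
    subst hx
    rcases hs.cast_inv with ⟨h, _⟩ | ⟨_, h, _⟩ | ⟨_, _, _, _, _, _, _, _, h, _⟩ |
      ⟨_, _, _, _, _, _, _, _, _, _, _, _, h, _⟩ | ⟨_, _, _, _, _, _, _, h, _⟩ |
      ⟨_, _, e', hs', rfl⟩ | ⟨_, _, h, _⟩
    · cases h
    · simp at h
    · cases h
    · cases h
    · cases h
    · cases hs' with
      | beta hv => exact ⟨e, hv.result, .refl⟩
      | appL h => simp at h
      | appR _ h =>
        obtain ⟨r', hr', hsr⟩ := ih rfl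
        exact ⟨r', hr', .head h hsr⟩
      | appRaiseR => exact ⟨_, .blame _, .refl⟩
    · cases h

/-- `Sim` is preserved by the context in which an unwrapped proxy evaluates its argument. -/
theorem Sim.cast_app_lam {T₁ T₂ T : Ty Sg} {S : Finset (Ty Sg)} {l : Option Sg.Label}
    {b e e' : Tm Sg} (h : Sim P e e') :
    Sim P (.cast T₁ (.ofFinset S) T₂ l (.app (.lam T b) e))
      (.cast T₁ (.ofFinset S) T₂ l (.app (.lam T b) e')) := by
  have hlam : Val .heedful (.lam T b) := .lam T b
  by_cases hr : ∃ r, Result .heedful r ∧ Steps P .heedful e' r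
  · obtain ⟨r, hr | ⟨l', rfl⟩, hs⟩ := hr
    · obtain ⟨v, hv, hs', hl⟩ := h.2 r hr hs
      exact (Sim.of_steps (hs'.cast_appR hlam)).trans
        ((Sim.of_labEq (.cast _ _ _ _ _ (.app (.refl _) hl))).trans
          (.of_steps_rev (hs.cast_appR hlam)))
    · obtain ⟨l'', hs'⟩ := h.1 ⟨l', hs⟩
      exact .of_blame ⟨l'', hs'.cast_appR_blame hlam⟩ ⟨l', hs.cast_appR_blame hlam⟩
  · refine ⟨?_, ?_⟩
    · rintro ⟨l', hs⟩
      exact (hr (result_of_cast_app_lam hs (.blame l'))).elim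
    · intro v hv hs
      exact (hr (result_of_cast_app_lam hs hv.result)).elim

/-- A heedful cast of a function value `v` evaluates to a value `u` that behaves like the wrapped
function, even where `v` is a proxy and the cast has been merged into it. Merging replaces the
label of the inner proxy, so that this holds only up to labels. -/
theorem exists_unwrap (hops : OpsSound P .heedful) {T₁₁ T₁₂ T₂₁ T₂₂ : Ty Sg}
    {S : Finset (Ty Sg)} {v : Tm Sg} (hv : Val .heedful v) (hok : Ok P v (.arrow T₁₁ T₁₂))
    (hc : OkCast P (.arrow T₁₁ T₁₂) S (.arrow T₂₁ T₂₂)) (l : Option Sg.Label) :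
    ∃ u, Val .heedful u ∧ Ok P u (.arrow T₂₁ T₂₂) ∧
      Steps P .heedful (.cast (.arrow T₁₁ T₁₂) (.ofFinset S) (.arrow T₂₁ T₂₂) l v) u ∧
      ∀ w, Val .heedful w → Ok P w T₂₁ →
        (∃ r, Result .heedful r ∧
          Steps P .heedful (.cast T₂₁ (.ofFinset (S.image Ty.dom)) T₁₁ l w) r) →
        Sim P (.app u w) (.cast T₁₂ (.ofFinset (S.image Ty.cod)) T₂₂ l
          (.app v (.cast T₂₁ (.ofFinset (S.image Ty.dom)) T₁₁ l w))) := by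
  have hcast := hok.cast hc l
  cases hv with
  | const k => obtain ⟨_, h, _⟩ := hok.1.const_inv; cases h
  | lam T b =>
    refine ⟨_, .proxyH, hcast, .refl, fun w hw _ _ => ?_⟩
    exact .of_steps (.single (.unwrap .proxyH hw (.set S) (.set S)))
  | @proxyH T₀₁ T₀₂ T₁₁' T₁₂' S₀ l₀ T b =>
    obtain ⟨hT, hlam, hc₀⟩ := hok.cast_inv
    cases hT
    have hv : Val .heedful (.cast (.arrow T₀₁ T₀₂) (.ofFinset S₀) (.arrow T₁₁ T₁₂) l₀
      (.lam T b)) := .proxyH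
    have hb : Val .heedful (.lam T b) := .lam T b
    have hs := Relation.ReflTransGen.single (Step.castMerge (P := P) (T₁ := .arrow T₀₁ T₀₂)
      (T₂ := .arrow T₁₁ T₁₂) (T₃ := .arrow T₂₁ T₂₂) (S₁ := S₀) (S₂ := S) (l₁ := l₀) (l₂ := l)
      (e := .lam T b))
    refine ⟨_, .proxyH, hcast.steps hops hs, hs, fun w hw hwok hr => ?_⟩
    obtain ⟨r, hr, hrs⟩ := hr
    have hdom : (S₀ ∪ S ∪ {.arrow T₁₁ T₁₂}).image Ty.dom =
        S.image Ty.dom ∪ S₀.image Ty.dom ∪ {T₁₁} := by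
      rw [Finset.image_union, Finset.image_union, Finset.image_singleton,
        Finset.union_comm (S₀.image _)]
      rfl
    have hcod : (S₀ ∪ S ∪ {.arrow T₁₁ T₁₂}).image Ty.cod =
        S₀.image Ty.cod ∪ S.image Ty.cod ∪ {T₁₂} := by
      rw [Finset.image_union, Finset.image_union, Finset.image_singleton]
      rfl
    -- unwrapping the merged proxy
    refine (Sim.of_steps (.single (.unwrap .proxyH hw (.set _) (.set _)))).trans ?_
    rw [hdom, hcod]
    -- the inner proxy would use its own label `l₀` for the cast of the argument
    refine (Sim.of_labEq (.cast _ _ _ l l (.app (.refl _)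
      (.cast _ _ _ l l₀ (.refl _))))).trans ?_
    -- the merged cast of the argument is a reduct of two nested casts
    refine (Sim.of_steps_rev (Steps.cast_appR hb (.single (.castMerge (l₁ := l))))).trans ?_
    refine (Sim.cast_app_lam (Sim.cast_steps hops (hwok.cast hc.dom l) hc₀.dom hrs)).trans ?_
    rcases hr with hr | ⟨l', rfl⟩
    · refine .of_steps_rev ((hrs.cast_appR hv).trans ?_)
      exact .head (.castInner (.heedful _) (by simp) (.unwrap hv hr (.set _) (.set _)))
        (.single .castMerge)
    · exact .of_blame ⟨l', Steps.cast_appR_blame hb (.single (.castRaise (.heedful _)))⟩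
        ⟨l', hrs.cast_appR_blame hv⟩

/-! ### Heedful normalization -/

/-- The normalizing values of the heedful mode, by recursion on the type. -/
def NormVal (P : Params Sg) : Ty Sg → Tm Sg → Prop
  | .refine B p, v => ∃ k : Sg.Const, v = .const k ∧ Sg.ty k = B ∧
      Steps P .heedful (p.inst (.const k)) (.const Sg.tt)
  | .arrow T₁ T₂, v => Val .heedful v ∧ Ok P v (.arrow T₁ T₂) ∧
      ∀ w, NormVal P T₁ w → (∃ l, Steps P .heedful (.app v w) (.blame l)) ∨
        ∃ r, NormVal P T₂ r ∧ Steps P .heedful (.app v w) r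

/-- `e` evaluates heedfully to blame or to a normalizing value of type `T`. -/
def Normalizes (P : Params Sg) (T : Ty Sg) (e : Tm Sg) : Prop :=
  (∃ l, Steps P .heedful e (.blame l)) ∨ ∃ r, NormVal P T r ∧ Steps P .heedful e r

theorem NormVal.val {T : Ty Sg} {v : Tm Sg} (h : NormVal P T v) : Val .heedful v := by
  cases T with
  | refine B p => simp only [NormVal] at h; obtain ⟨k, rfl, _⟩ := h; exact .const k
  | arrow T₁ T₂ => simp only [NormVal] at h; exact h.1

theorem NormVal.ok {T : Ty Sg} {v : Tm Sg} (h : NormVal P T v) (hT : WfTy P .heedful .runtime T) :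
    Ok P v T := by
  cases T with
  | refine B p =>
    simp only [NormVal] at h
    obtain ⟨k, rfl, hk, hs⟩ := h
    exact ⟨hasTy_const hk hT hs, .const k⟩
  | arrow T₁ T₂ => simp only [NormVal] at h; exact h.2.1

theorem NormVal.norm {T : Ty Sg} {v : Tm Sg} (h : NormVal P T v) : Normalizes P T v :=
  .inr ⟨v, h, .refl⟩

theorem NormVal.app {T₁ T₂ : Ty Sg} {v w : Tm Sg} (h : NormVal P (.arrow T₁ T₂) v)
    (hw : NormVal P T₁ w) : Normalizes P T₂ (.app v w) := by
  simp only [NormVal] at h; exact h.2.2 w hw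

theorem Normalizes.head {T : Ty Sg} {e e' : Tm Sg} (hs : Steps P .heedful e e') (h : Normalizes P T e') :
    Normalizes P T e := by
  rcases h with ⟨l, h⟩ | ⟨r, hr, h⟩
  · exact .inl ⟨l, hs.trans h⟩
  · exact .inr ⟨r, hr, hs.trans h⟩

theorem Normalizes.result {T : Ty Sg} {e : Tm Sg} (h : Normalizes P T e) :
    ∃ r, Result .heedful r ∧ Steps P .heedful e r := by
  rcases h with ⟨l, h⟩ | ⟨r, hr, h⟩
  · exact ⟨_, .blame l, h⟩
  · exact ⟨r, hr.val.result, h⟩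

theorem LabEq.eq_const {e : Tm Sg} {k : Sg.Const} (h : LabEq e (.const k)) : e = .const k := by
  cases h; rfl

/-- Normalizing values are closed under relabelling, within good typed terms. -/
theorem NormVal.labEq (hops : OpsSound P .heedful) : ∀ {T : Ty Sg} {v v' : Tm Sg},
    LabEq v v' → Ok P v T → NormVal P T v' → NormVal P T v
  | .refine B p, v, v', hl, _, h => by
    simp only [NormVal] at h ⊢
    obtain ⟨k, rfl, h⟩ := h
    exact ⟨k, hl.eq_const, h⟩
  | .arrow T₁ T₂, v, v', hl, hv, h => by
    simp only [NormVal] at h ⊢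
    refine ⟨hl.val h.1, hv, fun w hw => ?_⟩
    have happ : Ok P (.app v w) T₂ := hv.app (hw.ok (hv.1.wfTy hops).arrow_inv.1)
    have hsim : Sim P (.app v w) (.app v' w) := .of_labEq (.app hl (.refl w))
    rcases h.2.2 w hw with hb | ⟨r, hr, hs⟩
    · exact .inl (hsim.1 hb)
    · obtain ⟨r', _, hs', hl'⟩ := hsim.2 r hr.val hs
      exact .inr ⟨r', NormVal.labEq hops hl' (happ.steps hops hs') hr, hs'⟩

theorem Normalizes.sim (hops : OpsSound P .heedful) {T : Ty Sg} {e e' : Tm Sg} (he : Ok P e T)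
    (hsim : Sim P e e') (h : Normalizes P T e') : Normalizes P T e := by
  rcases h with hb | ⟨r, hr, hs⟩
  · exact .inl (hsim.1 hb)
  · obtain ⟨r', _, hs', hl'⟩ := hsim.2 r hr.val hs
    exact .inr ⟨r', hr.labEq hops hl' (he.steps hops hs'), hs'⟩

theorem Normalizes.cast_of_val (hops : OpsSound P .heedful) {T₁ T₂ : Ty Sg} {S : Finset (Ty Sg)}
    {l : Option Sg.Label} {e : Tm Sg} (he : Ok P e T₁) (hc : OkCast P T₁ S T₂)
    (h : Normalizes P T₁ e)
    (hval : ∀ v, NormVal P T₁ v → Normalizes P T₂ (.cast T₁ (.ofFinset S) T₂ l v)) :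
    Normalizes P T₂ (.cast T₁ (.ofFinset S) T₂ l e) := by
  rcases h with ⟨l', h⟩ | ⟨r, hr, hs⟩
  · exact .sim hops (he.cast hc l) (.cast_steps hops he hc h)
      (.inl ⟨l', .single (.castRaise (.heedful S))⟩)
  · exact .sim hops (he.cast hc l) (.cast_steps hops he hc hs) (hval r hr)

/-- Heedful casts between `T₁` and `T₂` take normalizing values to normalizing terms. -/
def CastNorm (P : Params Sg) (T₁ T₂ : Ty Sg) : Prop :=
  ∀ (S : Finset (Ty Sg)) (l : Option Sg.Label) (v : Tm Sg), OkCast P T₁ S T₂ → NormVal P T₁ v →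
    Normalizes P T₂ (.cast T₁ (.ofFinset S) T₂ l v)

theorem CastNorm.refine (B : Sg.Base) (p q : Tm Sg) :
    CastNorm P (.refine B p) (.refine B q) := by
  intro S l v hc hv
  simp only [NormVal] at hv
  obtain ⟨k, rfl, hk, _⟩ := hv
  rcases checksAll_cast_const (l := l) hk hc with ⟨hp, hs⟩ | ⟨_, hb⟩
  · refine .inr ⟨_, ?_, hs⟩
    simp only [NormVal]
    exact ⟨k, rfl, hk, hp B q (by simp)⟩
  · exact .inl hb

theorem CastNorm.arrow (hops : OpsSound P .heedful) {T₁₁ T₁₂ T₂₁ T₂₂ : Ty Sg}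
    (h₁ : CastNorm P T₂₁ T₁₁) (h₂ : CastNorm P T₁₂ T₂₂) :
    CastNorm P (.arrow T₁₁ T₁₂) (.arrow T₂₁ T₂₂) := by
  intro S l v hc hv
  have hvok := hv.ok hc.1.1
  obtain ⟨u, hu, huok, hus, hsim⟩ := exists_unwrap hops hv.val hvok hc l
  refine .inr ⟨u, ?_, hus⟩
  simp only [NormVal]
  refine ⟨hu, huok, fun w hw => ?_⟩
  have hwok : Ok P w T₂₁ := hw.ok hc.2.1.1.arrow_inv.1
  have harg := h₁ _ l w hc.dom hw
  refine Normalizes.sim hops (huok.app hwok) (hsim w hw.val hwok harg.result) ?_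
  rcases harg with ⟨l', hb⟩ | ⟨w', hw', hs⟩
  · exact .inl ⟨l', hb.cast_appR_blame hv.val⟩
  · refine .head (hs.cast_appR hv.val) ?_
    exact .cast_of_val hops (hvok.app (hw'.ok hc.1.1.arrow_inv.1)) hc.cod (hv.app hw')
      (fun v' hv' => h₂ _ l v' hc.cod hv')

theorem Compat.castNorm (hops : OpsSound P .heedful) {T₁ T₂ : Ty Sg} (h : Compat T₁ T₂) :
    CastNorm P T₁ T₂ ∧ CastNorm P T₂ T₁ := by
  induction h with
  | refine B p q => exact ⟨.refine B p q, .refine B q p⟩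
  | arrow _ _ ih₁ ih₂ => exact ⟨.arrow hops ih₁.2 ih₂.1, .arrow hops ih₁.1 ih₂.2⟩

/-- A normalizing cast of a normalizing term. -/
theorem Normalizes.cast (hops : OpsSound P .heedful) {T₁ T₂ : Ty Sg} {S : Finset (Ty Sg)}
    {l : Option Sg.Label} {e : Tm Sg} (he : Ok P e T₁) (hc : OkCast P T₁ S T₂)
    (h : Normalizes P T₁ e) : Normalizes P T₂ (.cast T₁ (.ofFinset S) T₂ l e) :=
  .cast_of_val hops he hc h (fun v hv => (hc.2.2.1.castNorm hops).1 S l v hc hv)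

/-- If every argument of an operation has a result and one of these is blame, then the operation
raises blame: the leftmost blame is propagated. -/
theorem op_blame_of_exists {m : Mode} {o : Sg.Op} {es : Fin (Sg.arity o) → Tm Sg}
    (h : ∀ i, (∃ l, Steps P m (es i) (.blame l)) ∨ ∃ k, Steps P m (es i) (.const k))
    (hb : ∃ i, ∃ l, Steps P m (es i) (.blame l)) : ∃ l, Steps P m (.op o es) (.blame l) := by
  obtain ⟨i, hi⟩ := hb
  induction i using WellFoundedLT.induction with
  | ind i ih =>
    by_cases hj : ∃ j < i, ∃ l, Steps P m (es j) (.blame l)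
    · obtain ⟨j, hj, hb⟩ := hj
      exact ih j hj hb
    · push Not at hj
      obtain ⟨l, hl⟩ := hi
      have : ∀ j, ∃ k, j < i → Steps P m (es j) (.const k) := by
        intro j
        by_cases hji : j < i
        · rcases h j with ⟨l, hl⟩ | ⟨k, hk⟩
          · exact (hj j hji l hl).elim
          · exact ⟨k, fun _ => hk⟩
        · exact ⟨Sg.tt, fun h => (hji h).elim⟩
      choose ks hks using this
      exact ⟨l, .op_blame hks hl⟩

theorem normVal_bool {v : Tm Sg} (h : NormVal P (.triv Sg.bool) v) :
    v = .const Sg.tt ∨ v = .const Sg.ff := by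
  simp only [Ty.triv, NormVal] at h
  obtain ⟨k, rfl, hk, _⟩ := h
  rcases (Sg.ty_eq_bool_iff k).1 hk with rfl | rfl
  · exact .inl rfl
  · exact .inr rfl

theorem Normalizes.halts {e : Tm Sg} (h : Normalizes P (.triv Sg.bool) e) : Halts P e := by
  rcases h with hb | ⟨r, hr, hs⟩
  · exact .inr (.inr hb)
  · rcases normVal_bool hr with rfl | rfl
    · exact .inl hs
    · exact .inr (.inl hs)

/-- Heedful normalization: well-typed terms in which all casts are between hereditarily halting
types evaluate to blame or to a value. -/
theorem HasTy.norm (hops : OpsSound P .heedful) {Γ : List (Ty Sg)} {e : Tm Sg} {T : Ty Sg}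
    (h : HasTy P .heedful .runtime Γ e T) (hg : GoodTm P e) {δ : ℕ → Tm Sg}
    (hδg : ∀ n, GoodTm P (δ n))
    (hδ : ∀ x U, Γ[x]? = some U → NormVal P U (δ x) ∧ Ok P (δ x) U) :
    Normalizes P T (e.subst δ) := by
  refine HasTy.rec (motive_1 := fun _ _ _ _ => True) (motive_2 := fun _ _ _ _ => True)
    (motive_3 := fun _ _ _ _ _ _ => True)
    (motive_4 := fun m s Γ e T _ => m = .heedful → s = .runtime → GoodTm P e →
      ∀ δ : ℕ → Tm Sg, (∀ n, GoodTm P (δ n)) →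
      (∀ x U, Γ[x]? = some U → NormVal P U (δ x) ∧ Ok P (δ x) U) → Normalizes P T (e.subst δ))
    ?empty ?extend ?base ?refine ?arrow ?none ?typeSet ?var ?const ?lam ?app ?op ?cast ?blame
    ?check h rfl rfl hg δ hδg hδ
  case var =>
    rintro m s Γ x T _ hx _ rfl rfl _ δ _ hδ
    exact (hδ x T hx).1.norm
  case const =>
    rintro m s Γ k p _ _ hs _ _ _ rfl rfl _ δ _ _
    refine NormVal.norm ?_
    simp only [NormVal]
    exact ⟨k, rfl, rfl, hs⟩
  case lam =>
    rintro m s Γ T₁ T₂ e hT he _ ih rfl rfl hg δ hδg hδ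
    refine NormVal.norm ?_
    simp only [NormVal]
    refine ⟨.lam _ _, ⟨(HasTy.lam hT he).subst [] δ (fun x U hx => (hδ x U hx).2.1) .empty,
      hg.subst hδg⟩, fun w hw => ?_⟩
    have hwok := hw.ok hT
    refine Normalizes.head (.single (.beta hw.val)) ?_
    rw [Tm.inst_subst_liftSubst]
    refine ih rfl rfl hg.lam_inv _ (hwok.2.scons hδg) fun x U hx => ?_
    cases x with
    | zero =>
      simp only [List.getElem?_cons_zero, Option.some.injEq] at hx
      subst hx
      exact ⟨hw, hwok⟩
    | succ x => exact hδ x U (by simpa using hx)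
  case app =>
    rintro m s Γ T₁ T₂ e₁ e₂ _ _ ih₁ ih₂ rfl rfl hg δ hδg hδ
    simp only [Tm.subst]
    rcases ih₁ rfl rfl hg.app_inv.1 δ hδg hδ with ⟨l, hb⟩ | ⟨v, hv, hs⟩
    · exact .inl ⟨l, hb.app_blameL⟩
    rcases ih₂ rfl rfl hg.app_inv.2 δ hδg hδ with ⟨l, hb⟩ | ⟨w, hw, hs'⟩
    · exact .inl ⟨l, hs.appL.trans (hb.app_blameR hv.val)⟩
    · exact .head (hs.appL.trans (hs'.appR hv.val)) (hv.app hw)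
  case op =>
    rintro m s Γ o es _ _ _ ih rfl rfl hg δ hδg hδ
    simp only [Tm.subst]
    have harg : ∀ i, (∃ l, Steps P .heedful ((es i).subst δ) (.blame l)) ∨
        ∃ k, Steps P .heedful ((es i).subst δ) (.const k) ∧ Sg.ty k = P.argBase o i ∧
          Steps P .heedful ((P.argPred o i).inst (.const k)) (.const Sg.tt) := by
      intro i
      rcases ih i rfl rfl (hg.op_inv i) δ hδg hδ with hb | ⟨r, hr, hs⟩
      · exact .inl hb
      · simp only [NormVal] at hr
        obtain ⟨k, rfl, hk⟩ := hr
        exact .inr ⟨k, hs, hk⟩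
    by_cases hb : ∃ i, ∃ l, Steps P .heedful ((es i).subst δ) (.blame l)
    · exact .inl (op_blame_of_exists (fun i => (harg i).imp_right fun ⟨k, hk⟩ => ⟨k, hk.1⟩) hb)
    · choose ks hs hks using fun i => (harg i).resolve_left fun h => hb ⟨i, h⟩
      have ho := (hops o).2.2 ks (fun i => (hks i).1)
      obtain ⟨k, hk⟩ := Option.isSome_iff_exists.1 (ho.1.2 fun i => (hks i).2)
      refine .inr ⟨.const k, ?_, (Steps.op_consts hs).tail (.op hk)⟩
      simp only [NormVal]
      exact ⟨k, rfl, ho.2 k hk⟩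
  case cast =>
    rintro m s Γ T₁ T₂ a l e he ha _ ih _ rfl rfl hg δ hδg hδ
    simp only [Tm.subst]
    obtain ⟨g₁, g₂, g₃, g₄⟩ := hg.cast_inv
    obtain ⟨w₁, w₂, hc, w₃⟩ := wfAnn_inv ha
    have heok : Ok P (e.subst δ) T₁ :=
      ⟨he.subst [] δ (fun x U hx => (hδ x U hx).2.1) .empty, g₄.subst hδg⟩
    have hn := ih rfl rfl g₄ δ hδg hδ
    cases ha with
    | none =>
      exact .head (.single .typeSet) (hn.cast hops heok (.empty ⟨w₁, g₁⟩ ⟨w₂, g₂⟩ hc))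
    | typeSet =>
      exact hn.cast hops heok ⟨⟨w₁, g₁⟩, ⟨w₂, g₂⟩, hc, fun U hU =>
        ⟨⟨(w₃ _ rfl U hU).1, g₃ _ rfl U hU⟩, (w₃ _ rfl U hU).2⟩⟩
  case blame =>
    rintro m Γ T l _ _ _ _ rfl _ _ δ _ _
    exact .inl ⟨l, .refl⟩
  case check =>
    rintro m Γ e₁ e₂ k l _ hw he₂ hs _ _ ih rfl _ hg δ hδg _
    simp only [Tm.subst]
    have hn := ih rfl rfl hg.check_inv δ hδg (by simp)
    rcases hn.halts with h | h | ⟨l', h⟩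
    · refine .inr ⟨.const k, ?_, .check_ok h⟩
      simp only [NormVal]
      rw [he₂.subst_closed] at h
      exact ⟨k, rfl, rfl, hs.trans h⟩
    · exact .inl ⟨l, .check_ff h⟩
    · exact .inl ⟨l', .check_blame h⟩
  all_goals intros; trivial

theorem goodTy_refine (hops : OpsSound P .heedful) {B : Sg.Base} {e : Tm Sg}
    (h : HasTy P .heedful .runtime [.triv B] e (.triv Sg.bool)) (hg : GoodTm P e) :
    GoodTy P (.refine B e) := by
  refine .refine hg fun k hk => ?_
  rw [Tm.inst_eq_subst]
  refine (h.norm hops hg ((GoodTm.const k).scons .var) fun x U hx => ?_).halts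
  cases x with
  | zero =>
    simp only [List.getElem?_cons_zero, Option.some.injEq] at hx
    subst hx
    have : NormVal P (.triv B) (.const k) := by
      simp only [Ty.triv, NormVal]
      exact ⟨k, rfl, hk, .refl⟩
    exact ⟨this, this.ok (.base B)⟩
  | succ x => simp at hx

theorem goodTy_triv (B : Sg.Base) : GoodTy P (.triv B) :=
  .refine (.const _) fun _ _ => .inl .refl

/-- All heedfully well-formed types are hereditarily halting, hence casts in well-typed terms are
always between such types. -/
theorem HasTy.goodTm (hops : OpsSound P .heedful) {Γ : List (Ty Sg)} {e : Tm Sg} {T : Ty Sg}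
    (h : HasTy P .heedful .runtime Γ e T) : GoodTm P e := by
  refine HasTy.rec (motive_1 := fun _ _ _ _ => True)
    (motive_2 := fun m s T _ => m = .heedful → s = .runtime → GoodTy P T)
    (motive_3 := fun m s a T₁ T₂ _ => m = .heedful → s = .runtime → GoodTy P T₁ ∧ GoodTy P T₂ ∧
      ∀ S, a = .ofFinset S → ∀ T ∈ S, GoodTy P T)
    (motive_4 := fun m s _ e _ _ => m = .heedful → s = .runtime → GoodTm P e)
    ?empty ?extend ?base ?refine ?arrow ?none ?typeSet ?var ?const ?lam ?app ?op ?cast ?blame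
    ?check h rfl rfl
  case empty => intros; trivial
  case extend => intros; trivial
  case base => intros; exact goodTy_triv _
  case refine => rintro m s B e he ih rfl rfl; exact goodTy_refine hops he (ih rfl rfl)
  case arrow => intro m s T₁ T₂ _ _ ih₁ ih₂ hm hs; exact .arrow (ih₁ hm hs) (ih₂ hm hs)
  case none =>
    intro m s T₁ T₂ _ _ _ ih₁ ih₂ hm hs
    exact ⟨ih₁ hm hs, ih₂ hm hs, by simp⟩
  case typeSet =>
    intro S T₁ T₂ _ _ _ _ _ ih₁ ih₂ ih₃ _ _
    refine ⟨ih₁ rfl rfl, ih₂ rfl rfl, fun S' hS T hT => ?_⟩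
    obtain rfl := Ann.ofFinset_inj.1 hS
    exact ih₃ T hT rfl rfl
  case var => intros; exact .var _
  case const => intros; exact .const _
  case lam => intro m s Γ T₁ T₂ e _ _ _ ih hm hs; exact .lam (ih hm hs)
  case app => intro m s Γ T₁ T₂ e₁ e₂ _ _ ih₁ ih₂ hm hs; exact .app (ih₁ hm hs) (ih₂ hm hs)
  case op => intro m s Γ o es _ _ _ ih hm hs; exact .op fun i => ih i hm hs
  case cast =>
    intro m s Γ T₁ T₂ a l e _ _ _ ih₁ ih₂ hm hs
    obtain ⟨h₁, h₂, h₃⟩ := ih₂ hm hs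
    exact .cast h₁ h₂ h₃ (ih₁ hm hs)
  case blame => intros; exact .blame _
  case check => intro m Γ e₁ e₂ k l _ _ _ _ _ _ ih hm hs; exact .check (ih hm rfl)

theorem HasTy.ok (hops : OpsSound P .heedful) {e : Tm Sg} {T : Ty Sg}
    (h : HasTy P .heedful .runtime [] e T) : Ok P e T :=
  ⟨h, h.goodTm hops⟩

theorem WfTy.goodTy (hops : OpsSound P .heedful) :
    ∀ {T : Ty Sg}, WfTy P .heedful .runtime T → GoodTy P T
  | .refine _ _, h => goodTy_refine hops h.refine_inv (h.refine_inv.goodTm hops)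
  | .arrow _ _, h => .arrow (WfTy.goodTy hops h.arrow_inv.1) (WfTy.goodTy hops h.arrow_inv.2)

theorem WfTy.ok (hops : OpsSound P .heedful) {T : Ty Sg} (h : WfTy P .heedful .runtime T) :
    OkTy P T :=
  ⟨h, h.goodTy hops⟩

/-! ### The logical relation -/

theorem ValRel.val {T : Ty Sg} {v₁ v₂ : Tm Sg} (h : ValRel P T v₁ v₂) :
    Val .classic v₁ ∧ Val .heedful v₂ := by
  cases T with
  | refine B p =>
    simp only [ValRel] at h
    obtain ⟨k, rfl, rfl, _⟩ := h
    exact ⟨.const k, .const k⟩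
  | arrow T₁ T₂ => simp only [ValRel] at h; exact ⟨h.1, h.2.1⟩

theorem ValRel.ok (hops : OpsSound P .heedful) {T : Ty Sg} {v₁ v₂ : Tm Sg}
    (h : ValRel P T v₁ v₂) (hT : WfTy P .heedful .runtime T) : Ok P v₂ T := by
  cases T with
  | refine B p =>
    simp only [ValRel] at h
    obtain ⟨k, _, rfl, hk, hs⟩ := h
    exact ⟨hasTy_const hk hT hs, .const k⟩
  | arrow T₁ T₂ => simp only [ValRel] at h; exact h.2.2.1.ok hops

theorem ValRel.app {T₁ T₂ : Ty Sg} {v₁ v₂ w₁ w₂ : Tm Sg} (h : ValRel P (.arrow T₁ T₂) v₁ v₂)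
    (hw : ValRel P T₁ w₁ w₂) : TermRel P T₂ (.app v₁ w₁) (.app v₂ w₂) := by
  simp only [ValRel] at h; exact h.2.2.2 w₁ w₂ hw

theorem ValRel.termRel {T : Ty Sg} {v₁ v₂ : Tm Sg} (h : ValRel P T v₁ v₂) :
    TermRel P T v₁ v₂ :=
  .inr ⟨v₁, v₂, h.val.1, h.val.2, .refl, .refl, h⟩

theorem valRel_triv {B : Sg.Base} {v₁ v₂ : Tm Sg} :
    ValRel P (.triv B) v₁ v₂ ↔ ∃ k, v₁ = .const k ∧ v₂ = .const k ∧ Sg.ty k = B := by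
  simp only [Ty.triv, ValRel]
  constructor
  · rintro ⟨k, h₁, h₂, hk, _⟩
    exact ⟨k, h₁, h₂, hk⟩
  · rintro ⟨k, h₁, h₂, hk⟩
    exact ⟨k, h₁, h₂, hk, .refl⟩

theorem TermRel.blame {T : Ty Sg} {e₁ e₂ : Tm Sg} {l l' : Option Sg.Label}
    (h₁ : Steps P .classic e₁ (.blame l)) (h₂ : Steps P .heedful e₂ (.blame l')) :
    TermRel P T e₁ e₂ :=
  .inl ⟨⟨l, h₁⟩, l', h₂⟩

theorem TermRel.head {T : Ty Sg} {e₁ e₂ e₁' e₂' : Tm Sg} (h₁ : Steps P .classic e₁ e₁')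
    (h₂ : Steps P .heedful e₂ e₂') (h : TermRel P T e₁' e₂') : TermRel P T e₁ e₂ := by
  rcases h with ⟨⟨l, hl⟩, l', hl'⟩ | ⟨v₁, v₂, hv₁, hv₂, hs₁, hs₂, hv⟩
  · exact .blame (h₁.trans hl) (h₂.trans hl')
  · exact .inr ⟨v₁, v₂, hv₁, hv₂, h₁.trans hs₁, h₂.trans hs₂, hv⟩

/-- The value relation does not depend on the labels of the heedful value, as long as that value
is well typed. -/
theorem ValRel.labEq (hops : OpsSound P .heedful) : ∀ {T : Ty Sg} {v₁ v₂ v₂' : Tm Sg},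
    LabEq v₂' v₂ → Ok P v₂' T → ValRel P T v₁ v₂ → ValRel P T v₁ v₂'
  | .refine B p, v₁, v₂, v₂', hl, _, h => by
    simp only [ValRel] at h ⊢
    obtain ⟨k, rfl, rfl, h⟩ := h
    exact ⟨k, rfl, hl.eq_const, h⟩
  | .arrow T₁ T₂, v₁, v₂, v₂', hl, hv, h => by
    simp only [ValRel] at h ⊢
    refine ⟨h.1, hl.val h.2.1, hv.1, fun w₁ w₂ hw => ?_⟩
    have happ : Ok P (.app v₂' w₂) T₂ := hv.app (hw.ok hops (hv.1.wfTy hops).arrow_inv.1)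
    have hsim : Sim P (.app v₂' w₂) (.app v₂ w₂) := .of_labEq (.app hl (.refl w₂))
    rcases h.2.2.2 w₁ w₂ hw with ⟨hb, hb'⟩ | ⟨r₁, r₂, hr₁, hr₂, hs₁, hs₂, hr⟩
    · exact .inl ⟨hb, hsim.1 hb'⟩
    · obtain ⟨r', hr', hs', hl'⟩ := hsim.2 r₂ hr₂ hs₂
      exact .inr ⟨r₁, r', hr₁, hr', hs₁, hs', ValRel.labEq hops hl' (happ.steps hops hs') hr⟩

theorem TermRel.sim (hops : OpsSound P .heedful) {T : Ty Sg} {e₁ e₂ e₂' : Tm Sg}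
    (he : Ok P e₂' T) (hsim : Sim P e₂' e₂) (h : TermRel P T e₁ e₂) : TermRel P T e₁ e₂' := by
  rcases h with ⟨hb, hb'⟩ | ⟨r₁, r₂, hr₁, hr₂, hs₁, hs₂, hr⟩
  · exact .inl ⟨hb, hsim.1 hb'⟩
  · obtain ⟨r', hr', hs', hl'⟩ := hsim.2 r₂ hr₂ hs₂
    exact .inr ⟨r₁, r', hr₁, hr', hs₁, hs', hr.labEq hops hl' (he.steps hops hs')⟩

/-- Casts from `T₁` to `T₂`, annotated with the empty type set in the heedful mode, take related
values to related terms. -/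
def CastRel (P : Params Sg) (T₁ T₂ : Ty Sg) : Prop :=
  ∀ (l l' : Option Sg.Label) (v₁ v₂ : Tm Sg), OkTy P T₁ → OkTy P T₂ → Compat T₁ T₂ →
    ValRel P T₁ v₁ v₂ →
    TermRel P T₂ (.cast T₁ .none T₂ l v₁) (.cast T₁ (.ofFinset ∅) T₂ l' v₂)

theorem CastRel.termRel (hops : OpsSound P .heedful) {T₁ T₂ : Ty Sg} (hcr : CastRel P T₁ T₂)
    {e₁ e₂ : Tm Sg} (h₁ : OkTy P T₁) (h₂ : OkTy P T₂) (hc : Compat T₁ T₂) (he : Ok P e₂ T₁)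
    (h : TermRel P T₁ e₁ e₂) (l l' : Option Sg.Label) :
    TermRel P T₂ (.cast T₁ .none T₂ l e₁) (.cast T₁ (.ofFinset ∅) T₂ l' e₂) := by
  have hcast : OkCast P T₁ ∅ T₂ := .empty h₁ h₂ hc
  rcases h with ⟨⟨l₁, hb₁⟩, l₂, hb₂⟩ | ⟨v₁, v₂, _, _, hs₁, hs₂, hv⟩
  · refine .sim hops (he.cast hcast l') (.cast_steps hops he hcast hb₂) (.blame
      (hb₁.classic_cast.tail (.castRaise .classic)) (.single (.castRaise (.heedful ∅))))
  · refine .sim hops (he.cast hcast l') (.cast_steps hops he hcast hs₂) ?_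
    exact .head hs₁.classic_cast .refl (hcr l l' v₁ v₂ h₁ h₂ hc hv)

theorem CastRel.refine {B : Sg.Base} {p q : Tm Sg}
    (hq : TyRel P (.refine B q) (.refine B q)) : CastRel P (.refine B p) (.refine B q) := by
  intro l l' v₁ v₂ _ _ _ hv
  simp only [ValRel] at hv
  obtain ⟨k, rfl, rfl, hk, _⟩ := hv
  refine .head (.single .checkNone) (.single .checkEmpty) ?_
  simp only [TyRel] at hq
  rcases hq.2 (.const k) (.const k) (valRel_triv.2 ⟨k, rfl, rfl, hk⟩) with
    ⟨⟨l₁, hb₁⟩, l₂, hb₂⟩ | ⟨r₁, r₂, _, _, hs₁, hs₂, hr⟩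
  · exact .blame (.check_blame hb₁) (.check_blame hb₂)
  · obtain ⟨k', rfl, rfl, hk'⟩ := valRel_triv.1 hr
    rcases (Sg.ty_eq_bool_iff k').1 hk' with rfl | rfl
    · refine .head (.check_ok hs₁) (.check_ok hs₂) (ValRel.termRel ?_)
      simp only [ValRel]
      exact ⟨k, rfl, rfl, hk, hs₂⟩
    · exact .blame (.check_ff hs₁) (.check_ff hs₂)

theorem CastRel.arrow (hops : OpsSound P .heedful) {T₁₁ T₁₂ T₂₁ T₂₂ : Ty Sg}
    (h₁ : CastRel P T₂₁ T₁₁) (h₂ : CastRel P T₁₂ T₂₂) :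
    CastRel P (.arrow T₁₁ T₁₂) (.arrow T₂₁ T₂₂) := by
  intro l l' v₁ v₂ ht₁ ht₂ hc hv
  have hcast : OkCast P (.arrow T₁₁ T₁₂) ∅ (.arrow T₂₁ T₂₂) := .empty ht₁ ht₂ hc
  have hvok := hv.ok hops ht₁.1
  obtain ⟨u, hu, huok, hus, hsim⟩ := exists_unwrap hops hv.val.2 hvok hcast l'
  have hproxy : Val .classic (.cast (.arrow T₁₁ T₁₂) .none (.arrow T₂₁ T₂₂) l v₁) :=
    .proxyC hv.val.1
  refine .head .refl hus (ValRel.termRel ?_)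
  simp only [ValRel]
  refine ⟨hproxy, hu, huok.1, fun w₁ w₂ hw => ?_⟩
  simp only [Finset.image_empty] at hsim
  have hwok : Ok P w₂ T₂₁ := hw.ok hops ht₂.1.arrow_inv.1
  have harg : TermRel P T₁₁ (.cast T₂₁ .none T₁₁ l w₁) (.cast T₂₁ (.ofFinset ∅) T₁₁ l' w₂) :=
    h₁ l l' w₁ w₂ ht₂.dom ht₁.dom hc.symm.dom hw
  have hunwrap : Steps P .classic
      (.app (.cast (.arrow T₁₁ T₁₂) .none (.arrow T₂₁ T₂₂) l v₁) w₁)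
      (.cast T₁₂ .none T₂₂ l (.app v₁ (.cast T₂₁ .none T₁₁ l w₁))) :=
    .single (.unwrap hproxy hw.val.1 .none .none)
  have hres : ∃ r, Result .heedful r ∧
      Steps P .heedful (.cast T₂₁ (.ofFinset ∅) T₁₁ l' w₂) r := by
    rcases harg with ⟨_, l₂, hb₂⟩ | ⟨_, r₂, _, hr₂, _, hs₂, _⟩
    · exact ⟨_, .blame l₂, hb₂⟩
    · exact ⟨r₂, hr₂.result, hs₂⟩
  refine TermRel.sim hops (huok.app hwok) (hsim w₂ hw.val.2 hwok hres) ?_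
  refine .head hunwrap .refl ?_
  rcases harg with ⟨⟨l₁, hb₁⟩, l₂, hb₂⟩ | ⟨r₁, r₂, _, _, hs₁, hs₂, hr⟩
  · exact .blame ((hb₁.app_blameR hv.val.1).classic_cast.tail (.castRaise .classic))
      (hb₂.cast_appR_blame hv.val.2)
  · refine .head (hs₁.appR hv.val.1).classic_cast (hs₂.cast_appR hv.val.2) ?_
    exact h₂.termRel hops ht₁.cod ht₂.cod hc.cod (hvok.app (hr.ok hops ht₁.1.arrow_inv.1))
      (hv.app hr) l l'

theorem Compat.castRel (hops : OpsSound P .heedful) {T₁ T₂ : Ty Sg} (h : Compat T₁ T₂)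
    (h₁ : TyRel P T₁ T₁) (h₂ : TyRel P T₂ T₂) : CastRel P T₁ T₂ ∧ CastRel P T₂ T₁ := by
  induction h with
  | refine B p q => exact ⟨.refine h₂, .refine h₁⟩
  | arrow _ _ ih₁ ih₂ =>
    simp only [TyRel] at h₁ h₂
    have ih₁ := ih₁ h₁.1 h₂.1
    have ih₂ := ih₂ h₁.2 h₂.2
    exact ⟨.arrow hops ih₁.2 ih₂.1, .arrow hops ih₁.1 ih₂.2⟩

theorem wfCtx_tail {m : Mode} {s : Kind} {Γ : List (Ty Sg)} {T : Ty Sg}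
    (h : WfCtx P m s (T :: Γ)) : WfCtx P m s Γ := by
  cases h with | extend h _ => exact h

theorem HasTy.wfCtx {m : Mode} {s : Kind} {Γ : List (Ty Sg)} {e : Tm Sg} {T : Ty Sg}
    (h : HasTy P m s Γ e T) : WfCtx P m s Γ := by
  refine HasTy.rec (motive_1 := fun _ _ _ _ => True) (motive_2 := fun _ _ _ _ => True)
    (motive_3 := fun _ _ _ _ _ _ => True) (motive_4 := fun m s Γ _ _ _ => WfCtx P m s Γ)
    ?empty ?extend ?base ?refine ?arrow ?none ?typeSet ?var ?const ?lam ?app ?op ?cast ?blame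
    ?check h
  case lam => intro m s Γ T₁ T₂ e _ _ _ ih; exact wfCtx_tail ih
  case app => intro m s Γ T₁ T₂ e₁ e₂ _ _ ih _; exact ih
  case cast => intro m s Γ T₁ T₂ a l e _ _ _ ih _; exact ih
  all_goals intros; trivial

/-- Related substitutions whose heedful component is moreover well typed. -/
def OkCtxRel (P : Params Sg) (Γ : List (Ty Sg)) (δ₁ δ₂ : ℕ → Tm Sg) : Prop :=
  ∀ x U, Γ[x]? = some U → ValRel P U (δ₁ x) (δ₂ x) ∧ Ok P (δ₂ x) U

theorem OkCtxRel.scons {Γ : List (Ty Sg)} {δ₁ δ₂ : ℕ → Tm Sg} {T : Ty Sg} {w₁ w₂ : Tm Sg}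
    (h : OkCtxRel P Γ δ₁ δ₂) (hw : ValRel P T w₁ w₂) (hok : Ok P w₂ T) :
    OkCtxRel P (T :: Γ) (Tm.scons w₁ δ₁) (Tm.scons w₂ δ₂) := by
  intro x U hx
  cases x with
  | zero =>
    simp only [List.getElem?_cons_zero, Option.some.injEq] at hx
    subst hx
    exact ⟨hw, hok⟩
  | succ x => exact h x U (by simpa using hx)

theorem OkCtxRel.subst_ok (hops : OpsSound P .heedful) {Γ : List (Ty Sg)} {δ₁ δ₂ : ℕ → Tm Sg}
    (hδ : OkCtxRel P Γ δ₁ δ₂) {m : Mode} {e : Tm Sg} {T : Ty Sg} (h : HasTy P m .source Γ e T) :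
    Ok P (e.subst δ₂) T :=
  (h.source_to_runtime.subst [] δ₂ (fun x U hx => (hδ x U hx).2.1) .empty).ok hops

theorem CtxRel.ok (hops : OpsSound P .heedful) {Γ : List (Ty Sg)} {δ₁ δ₂ : ℕ → Tm Sg}
    (h : CtxRel P Γ δ₁ δ₂) {m : Mode} {e : Tm Sg} {T : Ty Sg} (he : HasTy P m .source Γ e T) :
    OkCtxRel P Γ δ₁ δ₂ := fun x U hx =>
  ⟨h x U hx, (h x U hx).ok hops (wfCtx_getElem he.wfCtx hx).source_to_runtime⟩

theorem TermRel.op (hops : ∀ m, OpsSound P m) {o : Sg.Op} {es₁ es₂ : Fin (Sg.arity o) → Tm Sg}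
    (h : ∀ i, TermRel P (.refine (P.argBase o i) (P.argPred o i)) (es₁ i) (es₂ i)) :
    TermRel P (.refine (P.resBase o) (P.resPred o)) (.op o es₁) (.op o es₂) := by
  have harg : ∀ i, ((∃ l, Steps P .classic (es₁ i) (.blame l)) ∧
        ∃ l, Steps P .heedful (es₂ i) (.blame l)) ∨
      ∃ k, Steps P .classic (es₁ i) (.const k) ∧ Steps P .heedful (es₂ i) (.const k) ∧
        Sg.ty k = P.argBase o i ∧
        Steps P .heedful ((P.argPred o i).inst (.const k)) (.const Sg.tt) := by
    intro i
    rcases h i with hb | ⟨r₁, r₂, _, _, hs₁, hs₂, hr⟩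
    · exact .inl hb
    · simp only [ValRel] at hr
      obtain ⟨k, rfl, rfl, hk⟩ := hr
      exact .inr ⟨k, hs₁, hs₂, hk⟩
  by_cases hb : ∃ i, (∃ l, Steps P .classic (es₁ i) (.blame l)) ∧
      ∃ l, Steps P .heedful (es₂ i) (.blame l)
  · obtain ⟨i, hb₁, hb₂⟩ := hb
    exact .inl
      ⟨op_blame_of_exists (fun i => (harg i).imp (·.1) fun ⟨k, hk⟩ => ⟨k, hk.1⟩) ⟨i, hb₁⟩,
        op_blame_of_exists (fun i => (harg i).imp (·.2) fun ⟨k, hk⟩ => ⟨k, hk.2.1⟩) ⟨i, hb₂⟩⟩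
  · choose ks hs₁ hs₂ hk hks using fun i => (harg i).resolve_left fun h => hb ⟨i, h⟩
    have ho := (hops .heedful o).2.2 ks hk
    obtain ⟨k, hdk⟩ := Option.isSome_iff_exists.1 (ho.1.2 hks)
    refine .head ((Steps.op_consts hs₁).tail (.op hdk)) ((Steps.op_consts hs₂).tail (.op hdk))
      (ValRel.termRel ?_)
    simp only [ValRel]
    exact ⟨k, rfl, rfl, ho.2 k hdk⟩

theorem TyRel.refine {B : Sg.Base} {p : Tm Sg}
    (h : ∀ δ₁ δ₂ : ℕ → Tm Sg, OkCtxRel P [.triv B] δ₁ δ₂ →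
      TermRel P (.triv Sg.bool) (p.subst δ₁) (p.subst δ₂)) :
    TyRel P (.refine B p) (.refine B p) := by
  simp only [TyRel]
  refine ⟨trivial, fun w₁ w₂ hw => ?_⟩
  rw [Tm.inst_eq_subst, Tm.inst_eq_subst]
  refine h _ _ (OkCtxRel.scons (Γ := []) (fun x U hx => by simp at hx) hw ?_)
  obtain ⟨k, rfl, rfl, hk⟩ := valRel_triv.1 hw
  exact ⟨hasTy_const_triv hk, .const k⟩

/-- Well-typed source programs are related to themselves under related substitutions. The proof
shows along the way that all types of casts in the program are related to themselves. -/
theorem HasTy.termRel (hops : ∀ m, OpsSound P m) {Γ : List (Ty Sg)} {e : Tm Sg} {T : Ty Sg}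
    (h : HasTy P .classic .source Γ e T) {δ₁ δ₂ : ℕ → Tm Sg} (hδ : OkCtxRel P Γ δ₁ δ₂) :
    TermRel P T (e.subst δ₁) (e.subst δ₂) := by
  refine HasTy.rec (motive_1 := fun _ _ _ _ => True)
    (motive_2 := fun m s T _ => m = .classic → s = .source → TyRel P T T)
    (motive_3 := fun m s _ T₁ T₂ _ => m = .classic → s = .source → TyRel P T₁ T₁ ∧ TyRel P T₂ T₂)
    (motive_4 := fun m s Γ e T _ => m = .classic → s = .source →
      ∀ δ₁ δ₂ : ℕ → Tm Sg, OkCtxRel P Γ δ₁ δ₂ → TermRel P T (e.subst δ₁) (e.subst δ₂))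
    ?empty ?extend ?base ?refine ?arrow ?none ?typeSet ?var ?const ?lam ?app ?op ?cast ?blame
    ?check h rfl rfl δ₁ δ₂ hδ
  case empty => intros; trivial
  case extend => intros; trivial
  case base =>
    intro m s B _ _
    exact .refine fun _ _ _ =>
      (valRel_triv.2 ⟨Sg.tt, rfl, rfl, Signature.ty_tt⟩ : ValRel P _ _ _).termRel
  case refine => intro m s B p _ ih hm hs; exact .refine (ih hm hs)
  case arrow =>
    intro m s T₁ T₂ _ _ ih₁ ih₂ hm hs
    simp only [TyRel]
    exact ⟨ih₁ hm hs, ih₂ hm hs⟩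
  case none => intro m s T₁ T₂ _ _ _ ih₁ ih₂ hm hs; exact ⟨ih₁ hm hs, ih₂ hm hs⟩
  case typeSet => intro S T₁ T₂ _ _ _ _ _ _ _ _ hm; cases hm
  case var => intro m s Γ x T _ hx _ _ _ δ₁ δ₂ hδ; exact (hδ x T hx).1.termRel
  case const =>
    intro m s Γ k p _ _ _ hp _ _ _ hs δ₁ δ₂ _
    obtain rfl := hp hs
    exact (valRel_triv.2 ⟨k, rfl, rfl, rfl⟩ : ValRel P _ _ _).termRel
  case lam =>
    rintro m s Γ T₁ T₂ e hT he _ ih rfl rfl δ₁ δ₂ hδ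
    refine ValRel.termRel ?_
    simp only [ValRel]
    refine ⟨.lam _ _, .lam _ _, (hδ.subst_ok (hops _) (.lam hT he)).1, fun w₁ w₂ hw => ?_⟩
    refine TermRel.head (.single (.beta hw.val.1)) (.single (.beta hw.val.2)) ?_
    rw [Tm.inst_subst_liftSubst, Tm.inst_subst_liftSubst]
    exact ih rfl rfl _ _ (hδ.scons hw (hw.ok (hops _) hT.source_to_runtime))
  case app =>
    rintro m s Γ T₁ T₂ e₁ e₂ _ _ ih₁ ih₂ rfl rfl δ₁ δ₂ hδ
    simp only [Tm.subst]
    rcases ih₁ rfl rfl δ₁ δ₂ hδ with ⟨⟨l, hb⟩, l', hb'⟩ | ⟨v₁, v₂, hv₁, hv₂, hs₁, hs₂, hv⟩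
    · exact .blame hb.app_blameL hb'.app_blameL
    rcases ih₂ rfl rfl δ₁ δ₂ hδ with ⟨⟨l, hb⟩, l', hb'⟩ | ⟨w₁, w₂, _, _, hs₁', hs₂', hw⟩
    · exact .blame (hs₁.appL.trans (hb.app_blameR hv₁)) (hs₂.appL.trans (hb'.app_blameR hv₂))
    · exact .head (hs₁.appL.trans (hs₁'.appR hv₁)) (hs₂.appL.trans (hs₂'.appR hv₂)) (hv.app hw)
  case op =>
    rintro m s Γ o es _ _ _ ih rfl rfl δ₁ δ₂ hδ
    exact .op hops fun i => ih i rfl rfl δ₁ δ₂ hδ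
  case cast =>
    rintro m s Γ T₁ T₂ a l e he ha _ ih ihT rfl rfl δ₁ δ₂ hδ
    obtain ⟨h₁, h₂⟩ := ihT rfl rfl
    cases ha with
    | none w₁ w₂ hc =>
      refine .head .refl (.single .typeSet) ?_
      exact (hc.castRel (hops _) h₁ h₂).1.termRel (hops _) (w₁.source_to_runtime.ok (hops _))
        (w₂.source_to_runtime.ok (hops _)) hc (hδ.subst_ok (hops _) he) (ih rfl rfl δ₁ δ₂ hδ) l l
  case blame => intro m Γ T l _ _ _ _ _ hs; cases hs
  case check => intro m Γ e₁ e₂ k l _ _ _ _ _ _ _ _ hs; cases hs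

theorem WfTy.tyRel (hops : ∀ m, OpsSound P m) : ∀ {T : Ty Sg},
    WfTy P .classic .source T → TyRel P T T
  | .refine _ _, h => .refine fun _ _ hδ => h.refine_inv.termRel hops hδ
  | .arrow _ _, h => by
    simp only [TyRel]
    exact ⟨WfTy.tyRel hops h.arrow_inv.1, WfTy.tyRel hops h.arrow_inv.2⟩

/-- By determinism, related terms agree on blame and on all their values, not only on some
evaluation. -/
theorem TermRel.agree {T : Ty Sg} {e₁ e₂ : Tm Sg} (h : TermRel P T e₁ e₂) :
    ((∃ l, Steps P .classic e₁ (.blame l)) ↔ ∃ l', Steps P .heedful e₂ (.blame l')) ∧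
      ∀ v₁ v₂ : Tm Sg, Val .classic v₁ → Val .heedful v₂ →
        Steps P .classic e₁ v₁ → Steps P .heedful e₂ v₂ → ValRel P T v₁ v₂ := by
  rcases h with ⟨⟨l, hb₁⟩, l', hb₂⟩ | ⟨r₁, r₂, hr₁, hr₂, hs₁, hs₂, hr⟩
  · refine ⟨⟨fun _ => ⟨l', hb₂⟩, fun _ => ⟨l, hb₁⟩⟩, fun v₁ v₂ hv₁ _ hv _ => ?_⟩
    exact (not_val_blame (hv.result_unique hv₁.result hb₁ (.blame l) ▸ hv₁)).elim
  · refine ⟨⟨fun ⟨l, hb⟩ => ?_, fun ⟨l, hb⟩ => ?_⟩, fun v₁ v₂ hv₁ hv₂ hs₁' hs₂' => ?_⟩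
    · exact (not_val_blame (hs₁.result_unique hr₁.result hb (.blame l) ▸ hr₁)).elim
    · exact (not_val_blame (hs₂.result_unique hr₂.result hb (.blame l) ▸ hr₂)).elim
    · rw [hs₁'.result_unique hv₁.result hs₁ hr₁.result,
        hs₂'.result_unique hv₂.result hs₂ hr₂.result]
      exact hr

end

theorem mainTheorem4 (Sg : Signature) (P : Params Sg) (hops : ∀ m : Mode, OpsSound P m) :
    -- well-typed source programs are related to themselves
    (∀ (Γ : List (Ty Sg)) (e : Tm Sg) (T : Ty Sg),
      HasTy P .classic .source Γ e T → OpenRel P Γ e e T) ∧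
    -- well-formed source types are related to themselves
    (∀ T : Ty Sg, WfTy P .classic .source T → TyRel P T T) ∧
    -- hence blame agrees up to labels, and resulting values are related
    (∀ (Γ : List (Ty Sg)) (e : Tm Sg) (T : Ty Sg) (δ₁ δ₂ : ℕ → Tm Sg),
      HasTy P .classic .source Γ e T → CtxRel P Γ δ₁ δ₂ →
      ((∃ l, Steps P .classic (e.subst δ₁) (.blame l)) ↔
        (∃ l', Steps P .heedful (e.subst δ₂) (.blame l'))) ∧
      ∀ v₁ v₂ : Tm Sg, Val .classic v₁ → Val .heedful v₂ →
        Steps P .classic (e.subst δ₁) v₁ → Steps P .heedful (e.subst δ₂) v₂ →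
        ValRel P T v₁ v₂) := by
  refine ⟨fun Γ e T h δ₁ δ₂ hδ => h.termRel hops (hδ.ok (hops _) h), fun T h => h.tyRel hops,
    fun Γ e T δ₁ δ₂ h hδ => ?_⟩
  exact (h.termRel hops (hδ.ok (hops _) h)).agree
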